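/- Let $n\ge 0$ be an integer, let $A=\{1<2<\dots<n\}$, and let $C_n$ be the Chinese monoid of rank $n$, that is, the monoid presented by generators $A$ and relations $zyx=zxy$ and $zxy=yzx$ for all $x\le y\le z$ in $A$. Let $L\subseteq A^*$ be the language of Chinese staircase words, i.e. of all words $\ell^{(1)}\ell^{(2)}\cdots\ell^{(n)}$ with $$\ell^{(k)}=(k1)^{\sigma_{k1}}(k2)^{\sigma_{k2}}\cdots(k(k-1))^{\sigma_{k(k-1)}}k^{\sigma_k},\qquad \sigma_{kj},\sigma_k\in\{0,1,2,\dots\},$$ where $(kj)$ denotes the two-letter word $k\,j$. For $a\in A\cup\{\varepsilon\}$ let $$L_a=\{(u,v): u,v\in L,\ ua=_{C_n}v\},\qquad {}_aL=\{(u,v): u,v\in L,\ au=_{C_n}v\}.$$ For words $u,v\in A^*$ and a padding symbol $\$\notin A$, let $(u,v)\delta_{\mathrm R}$ (respectively $(u,v)\delta_{\mathrm L}$) be the word over $(A\cup\{\$\})\times(A\cup\{\$\})$ obtained by appending (respectively prepending) copies of $\$$ to the shorter of $u,v$ until the lengths agree, and then pairing the letters position by position. Then $(A,L)$ is a biautomatic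 structure for $C_n$: the set $A$ generates $C_n$, the language $L$ is regular, every element of $C_n$ is represented by at least one word in $L$, and for every $a\in A\cup\{\varepsilon\}$ the four languages $L_a\delta_{\mathrm R}$, ${}_aL\delta_{\mathrm R}$, $L_a\delta_{\mathrm L}$ and ${}_aL\delta_{\mathrm L}$ are regular. Moreover, for every $\gamma\in A$ the relations $L_\gamma$ and ${}_\gamma L$ are rational, i.e. each is the set of pairs (input label, output label) of accepting paths of a finite transducer. -/

import Mathlib

/-- The right-padded convolution of two words over `A`: the symbol `none` plays the role of the
padding symbol `$`, appended to the shorter word. -/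
def deltaR {A : Type*} (u v : List A) : List (Option A × Option A) :=
  List.zip ((u.map some).rightpad v.length none) ((v.map some).rightpad u.length none)

/-- The left-padded convolution of two words over `A`: the symbol `none` plays the role of the
padding symbol `$`, put in front of the shorter word. -/
def deltaL {A : Type*} (u v : List A) : List (Option A × Option A) :=
  List.zip ((u.map some).leftpad v.length none) ((v.map some).leftpad u.length none)

/-- The language `R δ_R` of right-padded convolutions of the pairs in a relation on words. -/
def rightPadded {A : Type*} (R : Set (List A × List A)) : Language (Option A × Option A) :=
  {w | ∃ u v : List A, (u, v) ∈ R ∧ w = deltaR u v}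

/-- The language `R δ_L` of left-padded convolutions of the pairs in a relation on words. -/
def leftPadded {A : Type*} (R : Set (List A × List A)) : Language (Option A × Option A) :=
  {w | ∃ u v : List A, (u, v) ∈ R ∧ w = deltaL u v}

/-- The element of the monoid `M` represented by a word over `A`, where each letter `a`
represents `φ a`. -/
def wordValue {A M : Type*} [Monoid M] (φ : A → M) (u : List A) : M :=
  (u.map φ).prod

/-- `L_a = {(u, v) : u, v ∈ L, u a =_M v}`, for `a` a letter (`some a`) or empty (`none`). -/
def rightMulRel {A M : Type*} [Monoid M] (φ : A → M) (L : Language A) (a : Option A) :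
    Set (List A × List A) :=
  {p | p.1 ∈ L ∧ p.2 ∈ L ∧ wordValue φ (p.1 ++ a.toList) = wordValue φ p.2}

/-- `ₐL = {(u, v) : u, v ∈ L, a u =_M v}`, for `a` a letter (`some a`) or empty (`none`). -/
def leftMulRel {A M : Type*} [Monoid M] (φ : A → M) (L : Language A) (a : Option A) :
    Set (List A × List A) :=
  {p | p.1 ∈ L ∧ p.2 ∈ L ∧ wordValue φ (a.toList ++ p.1) = wordValue φ p.2}

/-- `(A, L)` is a biautomatic structure for the monoid `M`, where the finite alphabet `A`
represents a set of generators of `M` through `φ : A → M`. -/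
structure IsBiautomaticStructure {A M : Type*} [Finite A] [Monoid M] (φ : A → M)
    (L : Language A) : Prop where
  generates : Submonoid.closure (Set.range φ) = ⊤
  regular : L.IsRegular
  surjective : ∀ m : M, ∃ u ∈ L, wordValue φ u = m
  right_rightPadded : ∀ a : Option A, (rightPadded (rightMulRel φ L a)).IsRegular
  left_rightPadded : ∀ a : Option A, (rightPadded (leftMulRel φ L a)).IsRegular
  right_leftPadded : ∀ a : Option A, (leftPadded (rightMulRel φ L a)).IsRegular
  left_leftPadded : ∀ a : Option A, (leftPadded (leftMulRel φ L a)).IsRegular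

/-- A finite transducer with input alphabet `A` and output alphabet `B`: finitely many states and
finitely many edges, each labelled by an input word and an output word. -/
structure FiniteTransducer (A B : Type*) where
  State : Type
  finite_state : Finite State
  start : State
  accept : Set State
  edges : Set (State × List A × List B × State)
  finite_edges : edges.Finite

/-- `T.Path p u v q`: there is a path in `T` from `p` to `q` with input label `u` and output
label `v`. -/
inductive FiniteTransducer.Path {A B : Type*} (T : FiniteTransducer A B) :
    T.State → List A → List B → T.State → Prop
  | nil (p : T.State) : FiniteTransducer.Path T p [] [] p
  | cons {p q r : T.State} {x u : List A} {y v : List B} (he : (p, x, y, q) ∈ T.edges)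
      (h : FiniteTransducer.Path T q u v r) : FiniteTransducer.Path T p (x ++ u) (y ++ v) r

/-- A rational relation: a relation on words recognized by a finite transducer. -/
def IsRationalRelation {A B : Type*} (R : Set (List A × List B)) : Prop :=
  ∃ T : FiniteTransducer A B,
    ∀ (u : List A) (v : List B), (u, v) ∈ R ↔ ∃ q ∈ T.accept, T.Path T.start u v q

/-- The defining relations of the Chinese monoid of rank `n`: `zyx = zxy` and `zxy = yzx` for
letters `x ≤ y ≤ z`. -/
inductive ChineseRel (n : ℕ) : FreeMonoid (Fin n) → FreeMonoid (Fin n) → Prop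
  | zyx_zxy (x y z : Fin n) (hxy : x ≤ y) (hyz : y ≤ z) :
      ChineseRel n (FreeMonoid.ofList [z, y, x]) (FreeMonoid.ofList [z, x, y])
  | zxy_yzx (x y z : Fin n) (hxy : x ≤ y) (hyz : y ≤ z) :
      ChineseRel n (FreeMonoid.ofList [z, x, y]) (FreeMonoid.ofList [y, z, x])

/-- The Chinese monoid `C_n` of rank `n`; the ordered alphabet `1 < ⋯ < n` is `Fin n`. -/
abbrev ChineseMonoid (n : ℕ) : Type := PresentedMonoid (ChineseRel n)

/-- The standard generators of the Chinese monoid. -/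
def chineseGen (n : ℕ) (a : Fin n) : ChineseMonoid n := PresentedMonoid.of (ChineseRel n) a

/-- The Chinese row `(k1)^{σ_{k1}} (k2)^{σ_{k2}} ⋯ (k(k-1))^{σ_{k(k-1)}} k^{σ_k}`, where `σ_{kj}`
is `σ k j` for `j < k` and `σ_k` is `σ k k`. -/
def chineseRow {n : ℕ} (σ : Fin n → Fin n → ℕ) (k : Fin n) : List (Fin n) :=
  ((List.finRange n).filter (fun j => j < k)).flatMap
      (fun j => (List.replicate (σ k j) [k, j]).flatten)
    ++ List.replicate (σ k k) k

/-- The Chinese staircase word with exponents `σ`: the product of its rows in increasing order. -/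
def chineseStaircaseWord {n : ℕ} (σ : Fin n → Fin n → ℕ) : List (Fin n) :=
  (List.finRange n).flatMap (chineseRow σ)

/-- The language of Chinese staircase words. -/
def chineseStaircaseLanguage (n : ℕ) : Language (Fin n) :=
  {w | ∃ σ : Fin n → Fin n → ℕ, w = chineseStaircaseWord σ}

/-!
Write a staircase word as a product `∏ w_{kj} ^ σ_{kj}` over the positions of the staircase, where
`w_{kj} = k j` for `j < k` and `w_{kk} = k`. The proof rests on two facts.

* Staircase words are normal forms, and multiplication of a staircase word by a generator, on the
  right or on the left, changes its exponents by amounts that depend only on which of them are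
  nonzero (`IsSupportLocal`).
* If a transformation `F` of exponents has this property, then its graph on words is a finite union
  of sets of pairs `(∏ w_i ^ (a_i + c_i), ∏ w_i ^ (a_i + d_i))` with constant exponents `c`, `d`
  and with `a` ranging over the families of exponents that vanish outside a fixed set (`boxRel`),
  one such set of pairs for each possible support. These sets are built from the empty pair by
  the operations `R ↦ (p, q) R` and `R ↦ (w, w)^* R`, so they are rational.

For the padded convolutions, the property `HasFiniteQuotients` of a relation `R`, that its left
quotients by pairs of words of length difference at most `K` are finitely many for each `K`, is
stable under the same two operations and under finite unions. Since the length differences are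
bounded, it implies by the Myhill–Nerode theorem that the right-padded convolutions form a regular
language. The left-padded case follows by reversal, as the reversal of a box is a box.

Right multiplication by a letter is insertion into the rows of the staircase from the last to the
first. A row is a priority queue (`rowInsert`): the letter `k` is simply added to the `k`-th row;
any other letter is added, and then the largest index is removed and handed on to the row above,
or lost if it equals `k`. Uniqueness of normal forms follows since insertion of words respects the
defining relations (`rightInsert_triple`): two words related by a relation leave the same row, and
hand on words which are again equal or related. This comes down to the effect of exchanging two
consecutive insertions (`rowInsert_swap`). Moreover, inserting a staircase word into the empty
staircase recovers its exponents (`rightInsert_zero_flatMap`).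

Left multiplication by a letter `l` lets a unit `l j`, or initially `l` alone, pass through the rows
above the `l`-th. In each row it exchanges its second letter with the smallest index of that row if
that is less than `j` (`unitVal_mul_unitVal`), and it comes to rest in the `l`-th row. Because
normal forms are unique, it is enough to verify this in the Chinese monoid.
-/

/-! ### Padded convolutions and left quotients -/

theorem deltaR_cons_cons {A : Type*} (a b : A) (u v : List A) :
    deltaR (a :: u) (b :: v) = (some a, some b) :: deltaR u v := by
  simp [deltaR, List.rightpad]

theorem deltaR_nil_cons {A : Type*} (b : A) (v : List A) :
    deltaR [] (b :: v) = (none, some b) :: deltaR [] v := by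
  simp [deltaR, List.rightpad, List.replicate_succ]

theorem deltaR_cons_nil {A : Type*} (a : A) (u : List A) :
    deltaR (a :: u) [] = (some a, none) :: deltaR u [] := by
  simp [deltaR, List.rightpad, List.replicate_succ]

theorem deltaR_nil_nil {A : Type*} : deltaR ([] : List A) [] = [] := rfl

theorem length_deltaR {A : Type*} (u v : List A) :
    (deltaR u v).length = max u.length v.length := by
  simp [deltaR, List.rightpad]
  omega

theorem deltaL_eq_reverse {A : Type*} (u v : List A) :
    deltaL u v = (deltaR u.reverse v.reverse).reverse := by
  unfold deltaL deltaR
  change List.zipWith Prod.mk _ _ = (List.zipWith Prod.mk _ _).reverse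
  rw [List.reverse_zipWith (by simp [List.rightpad]; omega)]
  simp [List.rightpad, List.leftpad, List.map_reverse]

theorem deltaR_append {A : Type*} {x y : List A} (h : x.length = y.length) (u v : List A) :
    deltaR (x ++ u) (y ++ v) = deltaR x y ++ deltaR u v := by
  induction x generalizing y with
  | nil => simp_all [eq_comm (a := 0), deltaR_nil_nil]
  | cons a x ih =>
    cases y with
    | nil => simp at h
    | cons b y => simp [deltaR_cons_cons, ih (by simpa using h)]

theorem deltaR_append_eq {A : Type*} {x y : List A} (h : x.length = y.length) {u v : List A}
    {z : List (Option A × Option A)} (he : deltaR x y ++ z = deltaR u v) :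
    ∃ u' v', u = x ++ u' ∧ v = y ++ v' ∧ z = deltaR u' v' := by
  induction x generalizing y u v with
  | nil =>
    obtain rfl : y = [] := by simpa [eq_comm] using h
    exact ⟨u, v, rfl, rfl, by simpa [deltaR_nil_nil] using he⟩
  | cons a x ih =>
    cases y with
    | nil => simp at h
    | cons b y =>
      rcases u with _ | ⟨c, u⟩ <;> rcases v with _ | ⟨d, v⟩ <;>
        simp only [deltaR_cons_cons, deltaR_nil_cons, deltaR_cons_nil, deltaR_nil_nil,
          List.cons_append, List.cons.injEq, Prod.mk.injEq, reduceCtorEq, false_and, and_false,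
          Option.some.injEq] at he
      obtain ⟨⟨rfl, rfl⟩, he⟩ := he
      obtain ⟨u', v', rfl, rfl, rfl⟩ := ih (by simpa using h) he
      exact ⟨u', v', rfl, rfl, rfl⟩

/-- A prefix of a convolution either contains no padding, or leaves a rest no longer than the
difference of the two lengths. -/
theorem eq_deltaR_or_length_le {A : Type*} {u v : List A} {w z : List (Option A × Option A)}
    (he : w ++ z = deltaR u v) :
    (∃ x y : List A, x.length = y.length ∧ w = deltaR x y) ∨
      u.length + z.length ≤ v.length ∨ v.length + z.length ≤ u.length := by
  induction w generalizing u v with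
  | nil => exact .inl ⟨[], [], rfl, rfl⟩
  | cons c w ih =>
    have hl := congrArg List.length he
    rw [length_deltaR] at hl
    rcases u with _ | ⟨a, u⟩
    · right; simp at hl ⊢; omega
    rcases v with _ | ⟨b, v⟩
    · right; simp at hl ⊢; omega
    rw [deltaR_cons_cons, List.cons_append, List.cons.injEq] at he
    obtain ⟨rfl, he⟩ := he
    rcases ih he with ⟨x, y, h, rfl⟩ | h
    · exact .inl ⟨a :: x, b :: y, by simpa using h, (deltaR_cons_cons ..).symm⟩
    · right; simp; omega

/-- The left quotient of a relation on words by a pair of words. -/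
def quotRel {A : Type*} (R : Set (List A × List A)) (x y : List A) : Set (List A × List A) :=
  {p | (x ++ p.1, y ++ p.2) ∈ R}

/-- A relation on words has finitely many left quotients by pairs of words whose lengths differ
by at most `K`, for every `K`. This is a Myhill–Nerode form of synchronous recognizability that is
stable under the constructions below. -/
def HasFiniteQuotients {A : Type*} (R : Set (List A × List A)) : Prop :=
  ∀ K : ℕ, {Q | ∃ x y : List A, x.length ≤ y.length + K ∧ y.length ≤ x.length + K ∧
    quotRel R x y = Q}.Finite

/-- The lengths of related words differ by a bounded amount. -/
def HasBoundedDifference {A : Type*} (R : Set (List A × List A)) : Prop :=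
  ∃ K : ℕ, ∀ u v, (u, v) ∈ R → u.length ≤ v.length + K ∧ v.length ≤ u.length + K

/-- The relation between the reversals of related words. -/
def revRel {A : Type*} (R : Set (List A × List A)) : Set (List A × List A) :=
  {p | (p.1.reverse, p.2.reverse) ∈ R}

/-- A left quotient of the convolution language is the convolution language of a left quotient of
the relation, as long as no padding has been read; afterwards only boundedly many symbols can
follow. -/
theorem HasFiniteQuotients.isRegular_rightPadded {A : Type*} [Finite A]
    {R : Set (List A × List A)} (hR : HasFiniteQuotients R) (hb : HasBoundedDifference R) :
    (rightPadded R).IsRegular := by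
  obtain ⟨K, hK⟩ := hb
  apply Language.IsRegular.of_finite_range_leftQuotient
  have hshort : {z : List (Option A × Option A) | z.length ≤ K}.Finite :=
    List.finite_length_le _ _
  refine (hshort.finite_subsets.union ((hR 0).image rightPadded)).subset ?_
  rintro _ ⟨w, rfl⟩
  by_cases hw : ∃ x y : List A, x.length = y.length ∧ w = deltaR x y
  · obtain ⟨x, y, h, rfl⟩ := hw
    refine .inr ⟨quotRel R x y, ⟨x, y, by omega, by omega, rfl⟩, ?_⟩
    ext z
    constructor
    · rintro ⟨u, v, huv, rfl⟩
      exact ⟨x ++ u, y ++ v, huv, (deltaR_append h u v).symm⟩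
    · rintro ⟨u, v, huv, he⟩
      obtain ⟨u', v', rfl, rfl, rfl⟩ := deltaR_append_eq h he
      exact ⟨u', v', huv, rfl⟩
  · left
    rintro z ⟨u, v, huv, he⟩
    have := hK u v huv
    rcases eq_deltaR_or_length_le he with h | h
    · exact absurd h hw
    · simp only [Set.mem_ofPred_eq]; omega

theorem HasBoundedDifference.revRel {A : Type*} {R : Set (List A × List A)}
    (hb : HasBoundedDifference R) : HasBoundedDifference (revRel R) := by
  obtain ⟨K, hK⟩ := hb
  exact ⟨K, fun u v h => by simpa using hK _ _ h⟩

theorem leftPadded_eq_reverse {A : Type*} (R : Set (List A × List A)) :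
    leftPadded R = (rightPadded (revRel R)).reverse := by
  ext w
  constructor
  · rintro ⟨u, v, h, rfl⟩
    exact ⟨u.reverse, v.reverse, by simpa [revRel] using h, by simp [deltaL_eq_reverse]⟩
  · rintro ⟨u, v, h, he⟩
    exact ⟨u.reverse, v.reverse, h, by simp [deltaL_eq_reverse, ← he]⟩

theorem HasFiniteQuotients.isRegular_leftPadded {A : Type*} [Finite A]
    {R : Set (List A × List A)} (hR : HasFiniteQuotients (revRel R))
    (hb : HasBoundedDifference R) : (leftPadded R).IsRegular := by
  rw [leftPadded_eq_reverse]
  exact (hR.isRegular_rightPadded hb.revRel).reverse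

/-- If the diagonal of a language has finitely many quotients, then the language is regular: the
quotient by `x` is the diagonal part of the quotient by `(x, x)`. -/
theorem HasFiniteQuotients.isRegular_of_diagonal {A : Type*} {R : Set (List A × List A)}
    (hR : HasFiniteQuotients R) {L : Language A} (hL : ∀ u, u ∈ L ↔ (u, u) ∈ R) :
    L.IsRegular := by
  apply Language.IsRegular.of_finite_range_leftQuotient
  refine ((hR 0).image fun Q => ({u | (u, u) ∈ Q} : Language A)).subset ?_
  rintro _ ⟨x, rfl⟩
  refine ⟨_, ⟨x, x, le_rfl, le_rfl, rfl⟩, ?_⟩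
  ext u
  exact (hL _).symm

/-! ### Constructions on relations -/

/-- `(p, q) R`. -/
def prefixRel {A : Type*} (p q : List A) (R : Set (List A × List A)) : Set (List A × List A) :=
  {r | ∃ u v, (u, v) ∈ R ∧ r = (p ++ u, q ++ v)}

/-- `(w, w)^* R`. -/
def loopRel {A : Type*} (w : List A) (R : Set (List A × List A)) : Set (List A × List A) :=
  {r | ∃ (a : ℕ) (u v : List A), (u, v) ∈ R ∧
    r = ((List.replicate a w).flatten ++ u, (List.replicate a w).flatten ++ v)}

theorem loopRel_nil {A : Type*} (R : Set (List A × List A)) : loopRel [] R = R := by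
  ext ⟨u, v⟩
  simp [loopRel]

theorem loopRel_eq_union {A : Type*} (w : List A) (R : Set (List A × List A)) :
    loopRel w R = R ∪ prefixRel w w (loopRel w R) := by
  ext r
  constructor
  · rintro ⟨_ | a, u, v, h, rfl⟩
    · exact .inl (by simpa using h)
    · exact .inr ⟨_, _, ⟨a, u, v, h, rfl⟩, by simp [List.replicate_succ]⟩
  · rintro (h | ⟨_, _, ⟨a, u, v, h, ⟨⟩⟩, rfl⟩)
    · exact ⟨0, r.1, r.2, h, by simp⟩
    · exact ⟨a + 1, u, v, h, by simp [List.replicate_succ]⟩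

theorem quotRel_prefixRel_append {A : Type*} (p q x y : List A) (R : Set (List A × List A)) :
    quotRel (prefixRel p q R) (p ++ x) (q ++ y) = quotRel R x y := by
  ext ⟨u, v⟩
  constructor
  · rintro ⟨u', v', h, he⟩
    simp only [List.append_assoc, Prod.mk.injEq, List.append_cancel_left_eq] at he
    obtain ⟨rfl, rfl⟩ := he
    exact h
  · intro h
    exact ⟨_, _, h, by simp⟩

theorem quotRel_prefixRel_eq_empty {A : Type*} {p q x y : List A} (R : Set (List A × List A))
    (hp : p.length ≤ x.length) (hq : q.length ≤ y.length) (h : ¬ (p <+: x ∧ q <+: y)) :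
    quotRel (prefixRel p q R) x y = ∅ := by
  refine Set.eq_empty_of_forall_notMem ?_
  rintro ⟨u, v⟩ ⟨u', v', -, he⟩
  obtain ⟨h1, h2⟩ := Prod.mk.inj he
  exact h ⟨List.prefix_of_prefix_length_le ⟨u', h1.symm⟩ (List.prefix_append ..) hp,
    List.prefix_of_prefix_length_le ⟨v', h2.symm⟩ (List.prefix_append ..) hq⟩

theorem finite_length_le_prod {A : Type*} [Finite A] (N : ℕ) :
    {xy : List A × List A | xy.1.length ≤ N ∧ xy.2.length ≤ N}.Finite :=
  (List.finite_length_le A N).prod (List.finite_length_le A N)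

theorem HasFiniteQuotients.prefixRel {A : Type*} [Finite A] {R : Set (List A × List A)}
    (hR : HasFiniteQuotients R) (p q : List A) : HasFiniteQuotients (prefixRel p q R) := by
  intro K
  refine (((hR (K + p.length + q.length)).union (Set.finite_singleton ∅)).union
    ((finite_length_le_prod (A := A) (K + p.length + q.length)).image
      fun xy => quotRel (_root_.prefixRel p q R) xy.1 xy.2)).subset ?_
  rintro _ ⟨x, y, hx, hy, rfl⟩
  by_cases hs : x.length < p.length ∨ y.length < q.length
  · refine .inr ⟨(x, y), ⟨?_, ?_⟩, rfl⟩ <;> dsimp only <;> omega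
  push Not at hs
  by_cases h : p <+: x ∧ q <+: y
  · obtain ⟨⟨x, rfl⟩, y, rfl⟩ := h
    simp only [List.length_append] at hx hy
    exact .inl (.inl ⟨x, y, by omega, by omega, (quotRel_prefixRel_append ..).symm⟩)
  · exact .inl (.inr (quotRel_prefixRel_eq_empty R hs.1 hs.2 h))

theorem quotRel_union {A : Type*} (R S : Set (List A × List A)) (x y : List A) :
    quotRel (R ∪ S) x y = quotRel R x y ∪ quotRel S x y := rfl

/-- Cancelling copies of `(w, w)` one at a time exhibits every quotient of `(w, w)^* R` as a union
of quotients of `R` and of one quotient by a pair one of whose words is shorter than `w`. -/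
theorem HasFiniteQuotients.loopRel {A : Type*} [Finite A] {R : Set (List A × List A)}
    (hR : HasFiniteQuotients R) (w : List A) : HasFiniteQuotients (loopRel w R) := by
  rcases eq_or_ne w [] with rfl | hw
  · rwa [loopRel_nil]
  intro K
  set S := _root_.prefixRel w w (_root_.loopRel w R) with hS
  have hfin : ((fun xy : List A × List A => quotRel S xy.1 xy.2) ''
      {xy | xy.1.length ≤ K + w.length ∧ xy.2.length ≤ K + w.length} ∪ {∅}).Finite :=
    ((finite_length_le_prod _).image _).union (Set.finite_singleton _)
  refine (Set.Finite.image2 (fun 𝒮 T => Set.sUnion 𝒮 ∪ T) (hR K).finite_subsets hfin).subset ?_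
  rintro _ ⟨x, y, hx, hy, rfl⟩
  induction hl : x.length using Nat.strong_induction_on generalizing x y with
  | _ l ih =>
  subst hl
  have hq : quotRel (_root_.loopRel w R) x y = quotRel R x y ∪ quotRel S x y := by
    rw [← quotRel_union, hS, ← loopRel_eq_union]
  have hbase : quotRel S x y ∈ ((fun xy : List A × List A => quotRel S xy.1 xy.2) ''
      {xy | xy.1.length ≤ K + w.length ∧ xy.2.length ≤ K + w.length} ∪ {∅}) →
      quotRel (_root_.loopRel w R) x y ∈ Set.image2 (fun 𝒮 T => Set.sUnion 𝒮 ∪ T)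
        {𝒮 | 𝒮 ⊆ {Q | ∃ x y : List A, x.length ≤ y.length + K ∧ y.length ≤ x.length + K ∧
          quotRel R x y = Q}} ((fun xy : List A × List A => quotRel S xy.1 xy.2) ''
      {xy | xy.1.length ≤ K + w.length ∧ xy.2.length ≤ K + w.length} ∪ {∅}) := fun h =>
    ⟨{quotRel R x y}, Set.singleton_subset_iff.2 ⟨x, y, hx, hy, rfl⟩, _, h, by simp [hq]⟩
  by_cases hs : x.length < w.length ∨ y.length < w.length
  · refine hbase (.inl ⟨(x, y), ⟨?_, ?_⟩, rfl⟩) <;> dsimp only <;> omega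
  push Not at hs
  by_cases h : w <+: x ∧ w <+: y
  · obtain ⟨⟨x, rfl⟩, y, rfl⟩ := h
    have hwl : 0 < w.length := List.length_pos_iff.2 hw
    obtain ⟨𝒮, h𝒮, T, hT, he⟩ := ih x.length (by simpa using hwl) x y
      (by simp only [List.length_append] at hx; omega)
      (by simp only [List.length_append] at hy; omega) rfl
    refine ⟨insert (quotRel R (w ++ x) (w ++ y)) 𝒮,
      Set.insert_subset ⟨_, _, hx, hy, rfl⟩ h𝒮, T, hT, ?_⟩
    dsimp only at he ⊢
    rw [hq, hS, quotRel_prefixRel_append, ← he, Set.sUnion_insert, Set.union_assoc]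
  · exact hbase (.inr (quotRel_prefixRel_eq_empty _ hs.1 hs.2 h))

theorem HasFiniteQuotients.iUnion {A ι : Type*} [Finite ι] {R : ι → Set (List A × List A)}
    (hR : ∀ i, HasFiniteQuotients (R i)) : HasFiniteQuotients (⋃ i, R i) := by
  intro K
  refine ((Set.Finite.pi' fun i => hR i K).image fun f => ⋃ i, f i).subset ?_
  rintro _ ⟨x, y, hx, hy, rfl⟩
  refine ⟨fun i => quotRel (R i) x y, fun i => ⟨x, y, hx, hy, rfl⟩, ?_⟩
  ext p
  simp [quotRel]

theorem HasBoundedDifference.iUnion {A ι : Type*} [Finite ι] {R : ι → Set (List A × List A)}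
    (hR : ∀ i, HasBoundedDifference (R i)) : HasBoundedDifference (⋃ i, R i) := by
  choose K hK using hR
  obtain ⟨N, hN⟩ := (Set.finite_range K).bddAbove
  refine ⟨N, fun u v h => ?_⟩
  obtain ⟨i, hi⟩ := Set.mem_iUnion.1 h
  have := hK i u v hi
  have := hN ⟨i, rfl⟩
  omega

theorem hasFiniteQuotients_singleton_nil {A : Type*} [Finite A] :
    HasFiniteQuotients ({([], [])} : Set (List A × List A)) := by
  intro K
  refine (Set.toFinite {{([], [])}, ∅}).subset ?_
  rintro _ ⟨x, y, -, -, rfl⟩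
  by_cases h : x = [] ∧ y = []
  · left; ext ⟨u, v⟩; simp [quotRel, h]
  · right; ext ⟨u, v⟩; simp only [quotRel, Set.mem_ofPred_eq, Set.mem_singleton_iff, Prod.mk.injEq,
      List.append_eq_nil_iff, Set.mem_empty_iff_false, iff_false]; tauto

theorem isRationalRelation_singleton_nil {A : Type*} :
    IsRationalRelation ({([], [])} : Set (List A × List A)) := by
  refine ⟨⟨Unit, inferInstance, (), Set.univ, ∅, Set.finite_empty⟩, fun u v => ?_⟩
  constructor
  · rintro ⟨⟩
    exact ⟨(), trivial, .nil _⟩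
  · rintro ⟨q, -, h⟩
    cases h with
    | nil => rfl
    | cons he => exact he.elim

/-- A new initial state with a loop labelled `(w, w)` and an edge labelled `(p, q)` to the old
initial state. -/
theorem IsRationalRelation.loopRel_prefixRel {A : Type*} {R : Set (List A × List A)}
    (hR : IsRationalRelation R) (w p q : List A) :
    IsRationalRelation (loopRel w (prefixRel p q R)) := by
  obtain ⟨T, hT⟩ := hR
  have := T.finite_state
  let T' : FiniteTransducer A A :=
    { State := Option T.State
      finite_state := inferInstance
      start := none
      accept := some '' T.accept
      edges := {(none, w, w, none), (none, p, q, some T.start)} ∪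
        (fun e => (some e.1, e.2.1, e.2.2.1, some e.2.2.2)) '' T.edges
      finite_edges := (Set.toFinite _).union (T.finite_edges.image _) }
  have hlift : ∀ {s t u v}, T.Path s u v t → T'.Path (some s) u v (some t) := by
    intro s t u v h
    induction h with
    | nil => exact .nil _
    | cons he _ ih => exact .cons (.inr ⟨_, he, rfl⟩) ih
  have hproj : ∀ {s' t' u v}, T'.Path s' u v t' → ∀ {t}, t' = some t →
      (∀ s, s' = some s → T.Path s u v t) ∧
      (s' = none → ∃ (a : ℕ) (x y : List A), T.Path T.start x y t ∧
        u = (List.replicate a w).flatten ++ (p ++ x) ∧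
        v = (List.replicate a w).flatten ++ (q ++ y)) := by
    intro s' t' u v h t ht
    induction h with
    | nil =>
      subst ht
      exact ⟨by rintro s ⟨⟩; exact .nil _, by simp⟩
    | cons he _ ih =>
      obtain ⟨ih1, ih2⟩ := ih ht
      rcases he with (he | he) | ⟨e, he, h⟩
      · obtain ⟨rfl, rfl, rfl, rfl⟩ := by simpa using he
        obtain ⟨a, x, y, hp, rfl, rfl⟩ := ih2 rfl
        exact ⟨by simp, fun _ => ⟨a + 1, x, y, hp, by simp [List.replicate_succ]⟩⟩
      · obtain ⟨rfl, rfl, rfl, rfl⟩ := by simpa using he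
        exact ⟨by simp, fun _ => ⟨0, _, _, ih1 _ rfl, by simp⟩⟩
      · obtain ⟨s, x, y, r⟩ := e
        obtain ⟨rfl, rfl, rfl, rfl⟩ := by simpa using h
        exact ⟨by rintro _ ⟨⟩; exact .cons he (ih1 _ rfl), by simp⟩
  refine ⟨T', fun u v => ⟨?_, ?_⟩⟩
  · rintro ⟨a, _, _, ⟨x, y, h, ⟨⟩⟩, ⟨⟩⟩
    obtain ⟨t, ht, hp⟩ := (hT x y).1 h
    refine ⟨some t, ⟨t, ht, rfl⟩, ?_⟩
    induction a with
    | zero =>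
      simpa using FiniteTransducer.Path.cons (T := T') (p := none) (.inl (.inr rfl)) (hlift hp)
    | succ a ih =>
      simpa [List.replicate_succ] using
        FiniteTransducer.Path.cons (T := T') (p := none) (.inl (.inl rfl)) ih
  · rintro ⟨_, ⟨t, ht, rfl⟩, h⟩
    obtain ⟨a, x, y, hp, rfl, rfl⟩ := (hproj h rfl).2 rfl
    exact ⟨a, _, _, ⟨x, y, (hT x y).2 ⟨t, ht, hp⟩, rfl⟩, rfl⟩

/-- A new initial state with edges labelled by empty words to all the old initial states. -/
theorem IsRationalRelation.iUnion {A : Type*} {ι : Type} [Finite ι]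
    {R : ι → Set (List A × List A)} (hR : ∀ i, IsRationalRelation (R i)) :
    IsRationalRelation (⋃ i, R i) := by
  choose T hT using hR
  have := fun i => (T i).finite_state
  let T' : FiniteTransducer A A :=
    { State := Option (Σ i, (T i).State)
      finite_state := inferInstance
      start := none
      accept := ⋃ i, (fun s => some ⟨i, s⟩) '' (T i).accept
      edges := (Set.range fun i => (none, [], [], some ⟨i, (T i).start⟩)) ∪
        ⋃ i, (fun e => (some ⟨i, e.1⟩, e.2.1, e.2.2.1, some ⟨i, e.2.2.2⟩)) '' (T i).edges
      finite_edges := (Set.finite_range _).union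
        (Set.finite_iUnion fun i => (T i).finite_edges.image _) }
  have hlift : ∀ {i s t u v}, (T i).Path s u v t → T'.Path (some ⟨i, s⟩) u v (some ⟨i, t⟩) := by
    intro i s t u v h
    induction h with
    | nil => exact .nil _
    | cons he _ ih => exact .cons (.inr (Set.mem_iUnion.2 ⟨i, _, he, rfl⟩)) ih
  have hproj : ∀ {s' t' u v}, T'.Path s' u v t' → ∀ {i t}, t' = some ⟨i, t⟩ →
      (∀ j s, s' = some ⟨j, s⟩ → ∃ t₁, (⟨i, t⟩ : Σ i, (T i).State) = ⟨j, t₁⟩ ∧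
        (T j).Path s u v t₁) ∧
      (s' = none → (T i).Path (T i).start u v t) := by
    intro s' t' u v h i t ht
    induction h with
    | nil =>
      subst ht
      exact ⟨by rintro j s ⟨⟩; exact ⟨_, rfl, .nil _⟩, by simp⟩
    | cons he _ ih =>
      obtain ⟨ih1, ih2⟩ := ih ht
      rcases he with ⟨j, he⟩ | he
      · simp only [Prod.mk.injEq] at he
        obtain ⟨rfl, rfl, rfl, rfl⟩ := he
        refine ⟨by simp, fun _ => ?_⟩
        obtain ⟨t₁, ⟨⟩, hp⟩ := ih1 _ _ rfl
        exact hp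
      · obtain ⟨j, ⟨s, x, y, r⟩, hr, h⟩ := Set.mem_iUnion.1 he
        simp only [Prod.mk.injEq] at h
        obtain ⟨rfl, rfl, rfl, rfl⟩ := h
        refine ⟨?_, by simp⟩
        rintro _ _ ⟨⟩
        obtain ⟨t₁, h1, hp⟩ := ih1 _ _ rfl
        exact ⟨t₁, h1, .cons hr hp⟩
  refine ⟨T', fun u v => ⟨?_, ?_⟩⟩
  · intro h
    obtain ⟨i, hi⟩ := Set.mem_iUnion.1 h
    obtain ⟨t, ht, hp⟩ := (hT i u v).1 hi
    exact ⟨some ⟨i, t⟩, Set.mem_iUnion.2 ⟨i, t, ht, rfl⟩,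
      .cons (x := []) (y := []) (.inl ⟨i, rfl⟩) (hlift hp)⟩
  · rintro ⟨_, ht, h⟩
    obtain ⟨i, t, ht', rfl⟩ := Set.mem_iUnion.1 ht
    exact Set.mem_iUnion.2 ⟨i, (hT i u v).2 ⟨t, ht', (hproj h rfl).2 rfl⟩⟩

/-! ### Transformations of exponents that depend only on the support -/

/-- The word `∏ wᵢ ^ σᵢ`, the product being taken along the list `I` of indices. -/
def powerWord {A ι : Type*} (w : ι → List A) (I : List ι) (σ : ι → ℕ) : List A :=
  I.flatMap fun i => (List.replicate (σ i) (w i)).flatten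

theorem flatten_replicate_add {A : Type*} (a b : ℕ) (w : List A) :
    (List.replicate (a + b) w).flatten =
      (List.replicate a w).flatten ++ (List.replicate b w).flatten := by
  rw [List.replicate_add, List.flatten_append]

/-- The pairs `(∏ wᵢ ^ (aᵢ + cᵢ), ∏ wᵢ ^ (aᵢ + dᵢ))`, where the exponents `a` vanish outside
`s`. -/
def boxRel {A ι : Type*} (w : ι → List A) (I : List ι) (c d : ι → ℕ) (s : Set ι) :
    Set (List A × List A) :=
  {p | ∃ a : ι → ℕ, (∀ i ∉ s, a i = 0) ∧ p = (powerWord w I (a + c), powerWord w I (a + d))}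

theorem boxRel_nil {A ι : Type*} (w : ι → List A) (c d : ι → ℕ) (s : Set ι) :
    boxRel w [] c d s = {([], [])} := by
  ext p
  constructor
  · rintro ⟨a, -, rfl⟩; rfl
  · rintro rfl
    exact ⟨0, by simp, rfl⟩

theorem powerWord_congr {A ι : Type*} (w : ι → List A) {I : List ι} {σ τ : ι → ℕ}
    (h : ∀ i ∈ I, σ i = τ i) : powerWord w I σ = powerWord w I τ :=
  List.flatMap_congr fun i hi => by rw [h i hi]

open Classical in
theorem boxRel_cons {A ι : Type*} (w : ι → List A) {i : ι} {I : List ι} (hi : i ∉ I)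
    (c d : ι → ℕ) (s : Set ι) :
    boxRel w (i :: I) c d s = loopRel (if i ∈ s then w i else [])
      (prefixRel (List.replicate (c i) (w i)).flatten (List.replicate (d i) (w i)).flatten
        (boxRel w I c d s)) := by
  ext p
  constructor
  · rintro ⟨a, ha, rfl⟩
    refine ⟨a i, _, _, ⟨_, _, ⟨a, ha, rfl⟩, rfl⟩, ?_⟩
    by_cases his : i ∈ s <;>
      simp [powerWord, his, flatten_replicate_add, ha]
  · rintro ⟨b, _, _, ⟨_, _, ⟨a, ha, ⟨⟩⟩, ⟨⟩⟩, rfl⟩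
    refine ⟨Function.update a i (if i ∈ s then b else 0), fun j hj => ?_, ?_⟩
    · rcases eq_or_ne j i with rfl | hne
      · simp [hj]
      · simp [hne, ha j hj]
    · have h : ∀ c : ι → ℕ, powerWord w I (Function.update a i (if i ∈ s then b else 0) + c) =
          powerWord w I (a + c) := fun c => powerWord_congr w fun j hj => by
        have : j ≠ i := by rintro rfl; exact hi hj
        simp [this]
      simp only [powerWord, List.flatMap_cons] at h ⊢
      rw [h, h]
      by_cases his : i ∈ s <;> simp [his, flatten_replicate_add]

theorem hasFiniteQuotients_boxRel {A ι : Type*} [Finite A] (w : ι → List A) {I : List ι}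
    (hI : I.Nodup) (c d : ι → ℕ) (s : Set ι) : HasFiniteQuotients (boxRel w I c d s) := by
  induction I with
  | nil => rw [boxRel_nil]; exact hasFiniteQuotients_singleton_nil
  | cons i I ih =>
    obtain ⟨hi, hI⟩ := List.nodup_cons.1 hI
    rw [boxRel_cons w hi]
    exact ((ih hI).prefixRel _ _).loopRel _

theorem isRationalRelation_boxRel {A ι : Type*} (w : ι → List A) {I : List ι}
    (hI : I.Nodup) (c d : ι → ℕ) (s : Set ι) : IsRationalRelation (boxRel w I c d s) := by
  induction I with
  | nil => rw [boxRel_nil]; exact isRationalRelation_singleton_nil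
  | cons i I ih =>
    obtain ⟨hi, hI⟩ := List.nodup_cons.1 hI
    rw [boxRel_cons w hi]
    exact (ih hI).loopRel_prefixRel _ _ _

theorem length_powerWord_add {A ι : Type*} (w : ι → List A) (I : List ι) (σ τ : ι → ℕ) :
    (powerWord w I (σ + τ)).length = (powerWord w I σ).length + (powerWord w I τ).length := by
  induction I with
  | nil => rfl
  | cons i I ih =>
    simp only [powerWord, List.flatMap_cons, List.length_append] at ih ⊢
    rw [ih]
    simp [add_mul]
    omega

theorem hasBoundedDifference_boxRel {A ι : Type*} (w : ι → List A) (I : List ι)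
    (c d : ι → ℕ) (s : Set ι) : HasBoundedDifference (boxRel w I c d s) := by
  refine ⟨(powerWord w I c).length + (powerWord w I d).length, ?_⟩
  rintro _ _ ⟨a, -, ⟨⟩⟩
  rw [length_powerWord_add, length_powerWord_add]
  omega

theorem reverse_powerWord {A ι : Type*} (w : ι → List A) (I : List ι) (σ : ι → ℕ) :
    (powerWord w I σ).reverse = powerWord (fun i => (w i).reverse) I.reverse σ := by
  unfold powerWord
  rw [List.reverse_flatMap]
  congr 1
  funext i
  simp [List.reverse_flatten]

theorem revRel_boxRel {A ι : Type*} (w : ι → List A) (I : List ι) (c d : ι → ℕ) (s : Set ι) :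
    revRel (boxRel w I c d s) = boxRel (fun i => (w i).reverse) I.reverse c d s := by
  ext ⟨u, v⟩
  simp only [revRel, boxRel, Set.mem_ofPred_eq, Prod.mk.injEq, ← reverse_powerWord,
    List.reverse_eq_iff]

/-- A transformation `F` of exponents is *support-local* if the increments of the exponents under
`F` depend only on which exponents are nonzero. -/
def IsSupportLocal {ι : Type*} (F : (ι → ℕ) → ι → ℕ) : Prop :=
  ∀ σ τ : ι → ℕ, (∀ i, σ i = 0 → τ i = 0) → F (σ + τ) = F σ + τ

/-- The graph of `F`, as a relation between the words with the given exponents. -/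
def powerWordRel {A ι : Type*} (w : ι → List A) (I : List ι) (F : (ι → ℕ) → ι → ℕ) :
    Set (List A × List A) :=
  {p | ∃ σ, p = (powerWord w I σ, powerWord w I (F σ))}

theorem isSupportLocal_id {ι : Type*} : IsSupportLocal (id : (ι → ℕ) → ι → ℕ) :=
  fun _ _ _ => rfl

open Classical in
/-- There is one box for each possible support `s`; its constant exponents are the indicator
function of `s` and the image of that function under `F`. -/
theorem IsSupportLocal.powerWordRel_eq {A ι : Type*} {F : (ι → ℕ) → ι → ℕ}
    (hF : IsSupportLocal F) (w : ι → List A) (I : List ι) :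
    powerWordRel w I F = ⋃ s : Set ι, boxRel w I (s.indicator 1) (F (s.indicator 1)) s := by
  have key : ∀ (s : Set ι) (a : ι → ℕ), (∀ i ∉ s, a i = 0) →
      F (a + s.indicator 1) = a + F (s.indicator 1) := fun s a ha => by
    rw [add_comm, hF, add_comm]
    intro i hi
    exact ha i (by simpa using hi)
  ext p
  rw [Set.mem_iUnion]
  constructor
  · rintro ⟨σ, rfl⟩
    set s : Set ι := {i | σ i ≠ 0} with hs
    have hσ : σ = (σ - s.indicator 1) + s.indicator 1 := by
      funext i
      by_cases h : σ i = 0 <;> simp [hs, Set.indicator, h]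
      omega
    have h0 : ∀ i ∉ s, (σ - s.indicator (1 : ι → ℕ)) i = 0 := fun i hi => by
      have : σ i = 0 := by simpa [hs] using hi
      simp [this]
    refine ⟨s, σ - s.indicator 1, h0, ?_⟩
    rw [← key _ _ h0, ← hσ]
  · rintro ⟨s, a, ha, rfl⟩
    exact ⟨_, by rw [key s a ha]⟩

section SupportLocal

variable {A : Type*} {ι : Type} [Finite ι] {F : (ι → ℕ) → ι → ℕ}

theorem IsSupportLocal.isRationalRelation (hF : IsSupportLocal F) (w : ι → List A) {I : List ι}
    (hI : I.Nodup) : IsRationalRelation (powerWordRel w I F) := by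
  rw [hF.powerWordRel_eq]
  exact .iUnion fun s => isRationalRelation_boxRel w hI _ _ s

theorem IsSupportLocal.hasFiniteQuotients [Finite A] (hF : IsSupportLocal F) (w : ι → List A)
    {I : List ι} (hI : I.Nodup) : HasFiniteQuotients (powerWordRel w I F) := by
  rw [hF.powerWordRel_eq]
  exact .iUnion fun s => hasFiniteQuotients_boxRel w hI _ _ s

theorem IsSupportLocal.hasBoundedDifference (hF : IsSupportLocal F) (w : ι → List A)
    (I : List ι) : HasBoundedDifference (powerWordRel w I F) := by
  rw [hF.powerWordRel_eq]
  exact .iUnion fun s => hasBoundedDifference_boxRel w I _ _ s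

theorem IsSupportLocal.isRegular_rightPadded [Finite A] (hF : IsSupportLocal F)
    (w : ι → List A) {I : List ι} (hI : I.Nodup) :
    (rightPadded (powerWordRel w I F)).IsRegular :=
  (hF.hasFiniteQuotients w hI).isRegular_rightPadded (hF.hasBoundedDifference w I)

theorem IsSupportLocal.isRegular_leftPadded [Finite A] (hF : IsSupportLocal F)
    (w : ι → List A) {I : List ι} (hI : I.Nodup) :
    (leftPadded (powerWordRel w I F)).IsRegular := by
  refine HasFiniteQuotients.isRegular_leftPadded ?_ (hF.hasBoundedDifference w I)
  have : revRel (powerWordRel w I F) =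
      ⋃ s : Set ι, revRel (boxRel w I (s.indicator 1) (F (s.indicator 1)) s) := by
    rw [hF.powerWordRel_eq]
    ext p
    simp [revRel]
  rw [this]
  refine .iUnion fun s => ?_
  rw [revRel_boxRel]
  exact hasFiniteQuotients_boxRel _ (List.nodup_reverse.2 hI) _ _ s

end SupportLocal

/-! ### Rows of the Chinese staircase in the Chinese monoid -/

section Row

variable {n : ℕ}

/-- The word `k j`, or just `k` if `j = k`, whose powers make up the `k`-th row. -/
def unitWord (k j : Fin n) : List (Fin n) := if j = k then [k] else [k, j]

/-- The column indices of the `k`-th row of the staircase. -/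
def rowIndices (k : Fin n) : List (Fin n) :=
  ((List.finRange n).filter fun j => j < k) ++ [k]

theorem mem_rowIndices {k j : Fin n} : j ∈ rowIndices k ↔ j ≤ k := by
  simp [rowIndices, le_iff_lt_or_eq]

theorem nodup_rowIndices (k : Fin n) : (rowIndices k).Nodup := by
  refine List.nodup_append.2 ⟨(List.nodup_finRange n).filter _, List.nodup_singleton k, ?_⟩
  rintro a ha b hb rfl
  simp at ha hb
  exact ha.ne hb

theorem chineseRow_eq (σ : Fin n → Fin n → ℕ) (k : Fin n) :
    chineseRow σ k =
      (rowIndices k).flatMap fun j => (List.replicate (σ k j) (unitWord k j)).flatten := by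
  rw [chineseRow, rowIndices, List.flatMap_append]
  congr 1
  · refine List.flatMap_congr fun j hj => ?_
    have : j ≠ k := by simp at hj; exact hj.ne
    simp [unitWord, this]
  · simp [unitWord]

theorem wordValue_append {A M : Type*} [Monoid M] (φ : A → M) (u v : List A) :
    wordValue φ (u ++ v) = wordValue φ u * wordValue φ v := by
  simp [wordValue]

theorem wordValue_flatMap {A M ι : Type*} [Monoid M] (φ : A → M) (l : List ι)
    (f : ι → List A) : wordValue φ (l.flatMap f) = (l.map fun i => wordValue φ (f i)).prod := by
  induction l with
  | nil => rfl
  | cons i l ih => simp [wordValue_append, ih]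

theorem wordValue_flatten_replicate {A M : Type*} [Monoid M] (φ : A → M) (a : ℕ)
    (w : List A) : wordValue φ (List.replicate a w).flatten = wordValue φ w ^ a := by
  induction a with
  | zero => simp [wordValue]
  | succ a ih => simp [List.replicate_succ, wordValue_append, ih, pow_succ']

/-- The element of the Chinese monoid represented by `unitWord k j`. -/
def unitVal (k j : Fin n) : ChineseMonoid n := wordValue (chineseGen n) (unitWord k j)

theorem unitVal_self (k : Fin n) : unitVal k k = chineseGen n k := by
  simp [unitVal, unitWord, wordValue]

theorem unitVal_of_ne {k j : Fin n} (h : j ≠ k) :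
    unitVal k j = chineseGen n k * chineseGen n j := by
  simp [unitVal, unitWord, wordValue, h]

theorem chineseGen_zyx {x y z : Fin n} (hxy : x ≤ y) (hyz : y ≤ z) :
    chineseGen n z * chineseGen n y * chineseGen n x =
      chineseGen n z * chineseGen n x * chineseGen n y := by
  simpa [chineseGen, PresentedMonoid.of, mul_assoc, FreeMonoid.ofList_cons] using
    PresentedMonoid.mk_eq_mk_of_rel (ChineseRel.zyx_zxy x y z hxy hyz)

theorem chineseGen_zxy {x y z : Fin n} (hxy : x ≤ y) (hyz : y ≤ z) :
    chineseGen n z * chineseGen n x * chineseGen n y =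
      chineseGen n y * chineseGen n z * chineseGen n x := by
  simpa [chineseGen, PresentedMonoid.of, mul_assoc, FreeMonoid.ofList_cons] using
    PresentedMonoid.mk_eq_mk_of_rel (ChineseRel.zxy_yzx x y z hxy hyz)

theorem commute_unitVal_gen {j c k : Fin n} (hjc : j ≤ c) (hck : c ≤ k) :
    Commute (unitVal k j) (chineseGen n c) := by
  rcases eq_or_ne j k with rfl | h
  · obtain rfl := le_antisymm hjc hck
    rw [unitVal_self]
  · rw [unitVal_of_ne h, Commute, SemiconjBy, chineseGen_zxy hjc hck, mul_assoc]

theorem commute_unitVal {i c k l : Fin n} (hic : i ≤ c) (hck : c ≤ k) (hkl : k ≤ l) :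
    Commute (unitVal l i) (unitVal k c) := by
  have h1 := commute_unitVal_gen (hic.trans hck) hkl
  rcases eq_or_ne c k with rfl | h
  · rwa [unitVal_self]
  · rw [unitVal_of_ne h]
    exact h1.mul_right (commute_unitVal_gen hic (hck.trans hkl))

theorem commute_unitVal_row {i j k : Fin n} (hi : i ≤ k) (hj : j ≤ k) :
    Commute (unitVal k i) (unitVal k j) := by
  rcases le_total i j with h | h
  · exact commute_unitVal h hj le_rfl
  · exact (commute_unitVal h hi le_rfl).symm

theorem prod_map_pow_add_single {M ι : Type*} [Monoid M] [DecidableEq ι] (f : ι → M)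
    {l : List ι} (hl : l.Nodup) (hf : ∀ i ∈ l, ∀ j ∈ l, Commute (f i) (f j)) (r : ι → ℕ)
    {j : ι} (hj : j ∈ l) :
    (l.map fun i => f i ^ (r + Pi.single j 1 : ι → ℕ) i).prod =
      (l.map fun i => f i ^ r i).prod * f j := by
  induction l with
  | nil => simp at hj
  | cons i l ih =>
    obtain ⟨hi, hl⟩ := List.nodup_cons.1 hl
    simp only [List.map_cons, List.prod_cons]
    by_cases hij : j = i
    · subst hij
      have h1 : (l.map fun i => f i ^ (r + Pi.single j 1 : ι → ℕ) i) =
          l.map fun i => f i ^ r i := List.map_congr_left fun i hil => by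
        have : i ≠ j := by rintro rfl; exact hi hil
        simp [this]
      have h2 : Commute (f j) (l.map fun i => f i ^ r i).prod := by
        refine Commute.list_prod_right _ _ fun x hx => ?_
        obtain ⟨i, hil, rfl⟩ := List.mem_map.1 hx
        exact (hf j (by simp) i (by simp [hil])).pow_right _
      rw [h1]
      simp only [Pi.add_apply, Pi.single_eq_same, pow_succ, mul_assoc]
      rw [h2.eq]
    · have hjl : j ∈ l := by simpa [hij] using hj
      rw [ih hl (fun a ha b hb => hf a (by simp [ha]) b (by simp [hb])) hjl, mul_assoc]
      simp [Ne.symm hij]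

/-- The element of the Chinese monoid represented by a `k`-th row with exponents `r`. -/
def rowVal (k : Fin n) (r : Fin n → ℕ) : ChineseMonoid n :=
  ((rowIndices k).map fun j => unitVal k j ^ r j).prod

theorem wordValue_chineseRow (σ : Fin n → Fin n → ℕ) (k : Fin n) :
    wordValue (chineseGen n) (chineseRow σ k) = rowVal k (σ k) := by
  simp only [chineseRow_eq, wordValue_flatMap, wordValue_flatten_replicate]
  rfl

theorem rowVal_zero (k : Fin n) : rowVal k 0 = 1 := by
  simp [rowVal]

theorem rowVal_add_single {k j : Fin n} (r : Fin n → ℕ) (hj : j ≤ k) :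
    rowVal k (r + Pi.single j 1) = rowVal k r * unitVal k j :=
  prod_map_pow_add_single _ (nodup_rowIndices k) (fun _ hi _ hj =>
    commute_unitVal_row (mem_rowIndices.1 hi) (mem_rowIndices.1 hj)) r (mem_rowIndices.2 hj)

theorem commute_rowVal {k : Fin n} {r : Fin n → ℕ} {x : ChineseMonoid n}
    (h : ∀ j ≤ k, r j ≠ 0 → Commute x (unitVal k j)) : Commute x (rowVal k r) := by
  refine Commute.list_prod_right _ _ fun y hy => ?_
  obtain ⟨j, hj, rfl⟩ := List.mem_map.1 hy
  rcases eq_or_ne (r j) 0 with h0 | h0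
  · simp [h0]
  · exact (h j (mem_rowIndices.1 hj) h0).pow_right _

theorem sub_single_add_single {ι : Type*} [DecidableEq ι] {r : ι → ℕ} {j : ι} (h : r j ≠ 0) :
    r - Pi.single j 1 + Pi.single j 1 = r := by
  funext i
  rcases eq_or_ne i j with rfl | hne
  · simp; omega
  · simp [hne]

theorem add_sub_single {ι : Type*} [DecidableEq ι] {r : ι → ℕ} {j : ι} (h : r j ≠ 0)
    (s : ι → ℕ) : r + s - Pi.single j 1 = r - Pi.single j 1 + s := by
  conv_lhs => rw [← sub_single_add_single h]
  rw [add_right_comm, add_tsub_cancel_right]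

theorem rowVal_sub_single_mul {k j : Fin n} {r : Fin n → ℕ} (hj : j ≤ k) (h : r j ≠ 0) :
    rowVal k (r - Pi.single j 1) * unitVal k j = rowVal k r := by
  rw [← rowVal_add_single _ hj, sub_single_add_single h]

end Row

/-! ### Insertion from the right -/

section RightInsertion

variable {n : ℕ}

/-- The largest index `j ≤ k` with a nonzero exponent in the row `r` (and `k` if there is none). -/
def rowTop (k : Fin n) (r : Fin n → ℕ) : Fin n :=
  if h : (Finset.univ.filter fun j => j ≤ k ∧ r j ≠ 0).Nonempty then Finset.max' _ h else k

theorem rowTop_eq {k m : Fin n} {r : Fin n → ℕ} (hm : m ≤ k) (hr : r m ≠ 0)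
    (h : ∀ j ≤ k, r j ≠ 0 → j ≤ m) : rowTop k r = m := by
  have hmem : m ∈ Finset.univ.filter fun j => j ≤ k ∧ r j ≠ 0 := by simp [hm, hr]
  rw [rowTop, dif_pos ⟨m, hmem⟩]
  refine le_antisymm (Finset.max'_le _ _ _ fun j hj => ?_) (Finset.le_max' _ _ hmem)
  obtain ⟨h1, h2⟩ := by simpa using hj
  exact h j h1 h2

theorem rowTop_spec {k j : Fin n} {r : Fin n → ℕ} (hj : j ≤ k) (hr : r j ≠ 0) :
    rowTop k r ≤ k ∧ r (rowTop k r) ≠ 0 ∧ ∀ i ≤ k, r i ≠ 0 → i ≤ rowTop k r := by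
  have hne : (Finset.univ.filter fun j => j ≤ k ∧ r j ≠ 0).Nonempty := ⟨j, by simp [hj, hr]⟩
  rw [rowTop, dif_pos hne]
  obtain ⟨-, h1, h2⟩ := Finset.mem_filter.1 (Finset.max'_mem _ hne)
  exact ⟨h1, h2, fun i hi h => Finset.le_max' _ _ (by simp [hi, h])⟩

/-- Insertion of a letter `c ≤ k` into a `k`-th row from the right: the new row and the word, of
length at most one, that is handed on to the rows above. A row behaves as a priority queue: the
letter `k` is added, any other letter is added and then the largest index is removed and handed on,
unless it is `k`, which is lost. -/
def rowInsert (k : Fin n) (r : Fin n → ℕ) (c : Fin n) : (Fin n → ℕ) × List (Fin n) :=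
  if c = k then (r + Pi.single k 1, [])
  else (r + Pi.single c 1 - Pi.single (rowTop k (r + Pi.single c 1)) 1,
    if rowTop k (r + Pi.single c 1) = k then [] else [rowTop k (r + Pi.single c 1)])

theorem rowInsert_self (k : Fin n) (r : Fin n → ℕ) :
    rowInsert k r k = (r + Pi.single k 1, []) := by
  simp [rowInsert]

theorem rowInsert_of_ne {k c m : Fin n} {r : Fin n → ℕ} (hc : c ≠ k)
    (hm : rowTop k (r + Pi.single c 1) = m) :
    rowInsert k r c = (r + Pi.single c 1 - Pi.single m 1, if m = k then [] else [m]) := by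
  simp [rowInsert, hc, hm]

theorem add_single_ne_zero {ι : Type*} [DecidableEq ι] {r : ι → ℕ} {c j : ι} :
    (r + Pi.single c 1 : ι → ℕ) j ≠ 0 ↔ j = c ∨ r j ≠ 0 := by
  rcases eq_or_ne j c with rfl | h
  · simp
  · simp [h]

theorem rowTop_add_single_spec {k c : Fin n} (r : Fin n → ℕ) (hc : c ≤ k) :
    rowTop k (r + Pi.single c 1) ≤ k ∧ c ≤ rowTop k (r + Pi.single c 1) ∧
      (rowTop k (r + Pi.single c 1) = c ∨ r (rowTop k (r + Pi.single c 1)) ≠ 0) ∧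
      ∀ i ≤ k, r i ≠ 0 → i ≤ rowTop k (r + Pi.single c 1) := by
  obtain ⟨h1, h2, h3⟩ := rowTop_spec hc (add_single_ne_zero (r := r).2 (.inl rfl))
  exact ⟨h1, h3 c hc (by simp), add_single_ne_zero.1 h2,
    fun i hi h => h3 i hi (add_single_ne_zero.2 (.inr h))⟩

theorem rowTop_add_single_eq {k c m : Fin n} {r : Fin n → ℕ} (hc : c ≤ k) (hm : m ≤ k)
    (hcm : c ≤ m) (hr : m = c ∨ r m ≠ 0) (h : ∀ i ≤ k, r i ≠ 0 → i ≤ m) :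
    rowTop k (r + Pi.single c 1) = m :=
  rowTop_eq hm (add_single_ne_zero.2 hr) fun j hj hrj => by
    rcases add_single_ne_zero.1 hrj with rfl | h'
    · exact hcm
    · exact h j hj h'

theorem lt_of_mem_rowInsert {k c d : Fin n} {r : Fin n → ℕ} (hc : c ≤ k)
    (hd : d ∈ (rowInsert k r c).2) : d < k := by
  obtain ⟨h1, -⟩ := rowTop_add_single_spec r hc
  unfold rowInsert at hd
  split_ifs at hd with h h'
  · simp at hd
  · simp at hd
  · obtain rfl := by simpa using hd
    exact lt_of_le_of_ne h1 h'

theorem rowVal_mul_gen {k c : Fin n} (r : Fin n → ℕ) (hc : c ≤ k) :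
    rowVal k r * chineseGen n c =
      wordValue (chineseGen n) (rowInsert k r c).2 * rowVal k (rowInsert k r c).1 := by
  rcases eq_or_ne c k with rfl | hck
  · rw [rowInsert_self, rowVal_add_single r le_rfl, unitVal_self]
    simp [wordValue]
  obtain ⟨h1, h2, h3, h4⟩ := rowTop_add_single_spec r hc
  rw [rowInsert_of_ne hck rfl]
  generalize rowTop k (r + Pi.single c 1) = m at *
  rcases eq_or_ne m c with rfl | hmc
  · rw [add_tsub_cancel_right]
    simp only [hck, if_false]
    have : Commute (chineseGen n m) (rowVal k r) :=
      commute_rowVal fun j hj hrj => (commute_unitVal_gen (h4 j hj hrj) h1).symm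
    simp [wordValue, this.eq]
  · have hm0 : r m ≠ 0 := h3.resolve_left hmc
    have hrow : r + Pi.single c 1 - Pi.single m 1 = r - Pi.single m 1 + Pi.single c 1 := by
      funext i
      rcases eq_or_ne i m with rfl | hi
      · simp [hmc]
      · simp [hi]
    rw [hrow, rowVal_add_single _ hc, ← rowVal_sub_single_mul h1 hm0, unitVal_of_ne hck]
    rcases eq_or_ne m k with rfl | hmk
    · simp [wordValue, unitVal_self, mul_assoc]
    · have : Commute (chineseGen n m) (rowVal k (r - Pi.single m 1)) :=
        commute_rowVal fun j hj hrj =>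
          (commute_unitVal_gen (h4 j hj fun h0 => hrj (by simp [h0])) h1).symm
      rw [unitVal_of_ne hmk, mul_assoc, chineseGen_zyx h2 h1, chineseGen_zxy h2 h1]
      simp [wordValue, hmk, ← mul_assoc, this.eq]

/-- Insertion of the letters of a word into a row, from left to right: the new row and the word
that is handed on. -/
def rowRun (k : Fin n) : (Fin n → ℕ) → List (Fin n) → (Fin n → ℕ) × List (Fin n)
  | r, [] => (r, [])
  | r, c :: w => ((rowRun k (rowInsert k r c).1 w).1,
      (rowInsert k r c).2 ++ (rowRun k (rowInsert k r c).1 w).2)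

theorem rowRun_append (k : Fin n) (r : Fin n → ℕ) (u v : List (Fin n)) :
    rowRun k r (u ++ v) = ((rowRun k (rowRun k r u).1 v).1,
      (rowRun k r u).2 ++ (rowRun k (rowRun k r u).1 v).2) := by
  induction u generalizing r with
  | nil => rfl
  | cons c u ih => simp [rowRun, ih]

theorem lt_of_mem_rowRun {k : Fin n} {r : Fin n → ℕ} {w : List (Fin n)} (hw : ∀ c ∈ w, c ≤ k)
    {d : Fin n} (hd : d ∈ (rowRun k r w).2) : d < k := by
  induction w generalizing r with
  | nil => simp [rowRun] at hd
  | cons c w ih =>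
    rcases List.mem_append.1 hd with h | h
    · exact lt_of_mem_rowInsert (hw c (by simp)) h
    · exact ih (fun c hc => hw c (by simp [hc])) h

theorem rowVal_mul_wordValue {k : Fin n} (r : Fin n → ℕ) {w : List (Fin n)}
    (hw : ∀ c ∈ w, c ≤ k) :
    rowVal k r * wordValue (chineseGen n) w =
      wordValue (chineseGen n) (rowRun k r w).2 * rowVal k (rowRun k r w).1 := by
  induction w generalizing r with
  | nil => simp [wordValue, rowRun]
  | cons c w ih =>
    have h : wordValue (chineseGen n) (c :: w) =
        chineseGen n c * wordValue (chineseGen n) w := by simp [wordValue]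
    rw [h, ← mul_assoc, rowVal_mul_gen r (hw c (by simp)), mul_assoc,
      ih _ fun c hc => hw c (by simp [hc]), ← mul_assoc, ← wordValue_append]
    rfl

/-- Insertion of a word from the right into the rows listed in `ks`, the first of which is the
lowest row of the staircase. -/
def rightInsert : List (Fin n) → (Fin n → Fin n → ℕ) → List (Fin n) → Fin n → Fin n → ℕ
  | [], σ, _ => σ
  | k :: ks, σ, w =>
    Function.update (rightInsert ks σ (rowRun k (σ k) w).2) k (rowRun k (σ k) w).1

/-- A strictly decreasing list of letters whose members form a lower set. -/
def IsLowerChain (ks : List (Fin n)) : Prop :=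
  ks.Pairwise (· > ·) ∧ ∀ k ∈ ks, ∀ j ≤ k, j ∈ ks

namespace IsLowerChain

variable {k : Fin n} {ks : List (Fin n)}

theorem mem_tail (h : IsLowerChain (k :: ks)) {c : Fin n} (hc : c < k) : c ∈ ks := by
  simpa [hc.ne] using h.2 k (by simp) c hc.le

theorem lt_of_mem (h : IsLowerChain (k :: ks)) {c : Fin n} (hc : c ∈ ks) : c < k :=
  (List.pairwise_cons.1 h.1).1 c hc

theorem le_of_mem_cons (h : IsLowerChain (k :: ks)) {c : Fin n} (hc : c ∈ k :: ks) : c ≤ k := by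
  rcases List.mem_cons.1 hc with rfl | hc
  · exact le_rfl
  · exact (h.lt_of_mem hc).le

theorem tail (h : IsLowerChain (k :: ks)) : IsLowerChain ks :=
  ⟨(List.pairwise_cons.1 h.1).2, fun _ hl _ hj => h.mem_tail (hj.trans_lt (h.lt_of_mem hl))⟩

theorem notMem (h : IsLowerChain (k :: ks)) : k ∉ ks := fun hk => (h.lt_of_mem hk).false

theorem rowRun_mem (h : IsLowerChain (k :: ks)) {w : List (Fin n)} (hw : ∀ c ∈ w, c ∈ k :: ks)
    (r : Fin n → ℕ) :
    ∀ c ∈ (rowRun k r w).2, c ∈ ks := fun _ hc =>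
  h.mem_tail (lt_of_mem_rowRun (fun c hc => h.le_of_mem_cons (hw c hc)) hc)

end IsLowerChain

/-- The element of the Chinese monoid represented by the product of the rows listed in `ks`. -/
def rowsVal (ks : List (Fin n)) (σ : Fin n → Fin n → ℕ) : ChineseMonoid n :=
  (ks.map fun k => rowVal k (σ k)).prod

theorem wordValue_flatMap_chineseRow (ks : List (Fin n)) (σ : Fin n → Fin n → ℕ) :
    wordValue (chineseGen n) (ks.flatMap (chineseRow σ)) = rowsVal ks σ := by
  simp [wordValue_flatMap, wordValue_chineseRow, rowsVal]

theorem rowsVal_update {k : Fin n} {ks : List (Fin n)} (hk : k ∉ ks)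
    (σ : Fin n → Fin n → ℕ) (r : Fin n → ℕ) :
    rowsVal ks (Function.update σ k r) = rowsVal ks σ := by
  unfold rowsVal
  congr 1
  refine List.map_congr_left fun i hi => ?_
  have : i ≠ k := by rintro rfl; exact hk hi
  simp [this]

theorem rowsVal_reverse_cons (k : Fin n) (ks : List (Fin n)) (σ : Fin n → Fin n → ℕ) :
    rowsVal (k :: ks).reverse σ = rowsVal ks.reverse σ * rowVal k (σ k) := by
  simp [rowsVal]

theorem rowsVal_mul_wordValue {ks : List (Fin n)} (hks : IsLowerChain ks)
    (σ : Fin n → Fin n → ℕ) {w : List (Fin n)} (hw : ∀ c ∈ w, c ∈ ks) :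
    rowsVal ks.reverse σ * wordValue (chineseGen n) w =
      rowsVal ks.reverse (rightInsert ks σ w) := by
  induction ks generalizing w with
  | nil =>
    obtain rfl : w = [] := List.eq_nil_iff_forall_not_mem.2 fun c hc => by simpa using hw c hc
    simp [rightInsert, wordValue]
  | cons k ks ih =>
    have hk : k ∉ ks.reverse := by simpa using hks.notMem
    rw [rowsVal_reverse_cons, rowsVal_reverse_cons, mul_assoc,
      rowVal_mul_wordValue _ fun c hc => hks.le_of_mem_cons (hw c hc), ← mul_assoc,
      ih hks.tail (hks.rowRun_mem hw _), rightInsert, rowsVal_update hk,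
      Function.update_self]

/-- The three words of length three that the Chinese congruence identifies for letters
`x ≤ y ≤ z`. -/
def IsTriple (x y z : Fin n) (t : List (Fin n)) : Prop :=
  t = [z, y, x] ∨ t = [z, x, y] ∨ t = [y, z, x]

/-- Two words are equal, or are identified by one application of a defining relation. -/
def IsTriplePair (t t' : List (Fin n)) : Prop :=
  t = t' ∨ ∃ x y z, x ≤ y ∧ y ≤ z ∧ IsTriple x y z t ∧ IsTriple x y z t'

/-- Two letters below `k` inserted in either order leave the same row. They also hand on the same
letters in the same order, unless the larger letter `c` is at least every index of the row; then `c`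
itself is handed on at once, and the order of the two letters handed on is reversed. -/
theorem rowInsert_swap {k c d : Fin n} (r : Fin n → ℕ) (hck : c < k) (hdc : d ≤ c) :
    rowRun k r [c, d] = rowRun k r [d, c] ∨
    (∀ i ≤ k, r i ≠ 0 → i ≤ c) ∧ ∃ m, d ≤ m ∧ m ≤ c ∧
      (∀ i ≤ k, r i ≠ 0 → i ≤ m) ∧
      rowRun k r [c, d] = (r + Pi.single d 1 - Pi.single m 1, [c, m]) ∧
      rowRun k r [d, c] = (r + Pi.single d 1 - Pi.single m 1, [m, c]) := by
  have hdk := hdc.trans_lt hck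
  by_cases hr : ∀ i ≤ k, r i ≠ 0 → i ≤ c
  · right
    obtain ⟨h1, h2, h3, h4⟩ := rowTop_add_single_spec r hdk.le
    have hm := rowInsert_of_ne (r := r) hdk.ne rfl
    generalize rowTop k (r + Pi.single d 1) = m at *
    have hmc : m ≤ c := by
      rcases h3 with rfl | h3
      · exact hdc
      · exact hr m h1 h3
    have hmk := (hmc.trans_lt hck).ne
    have hc := rowInsert_of_ne (r := r) hck.ne
      (rowTop_add_single_eq hck.le hck.le le_rfl (.inl rfl) hr)
    have hc' : rowInsert k (r + Pi.single d 1 - Pi.single m 1) c =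
        (r + Pi.single d 1 - Pi.single m 1, [c]) := by
      rw [rowInsert_of_ne hck.ne (rowTop_add_single_eq hck.le hck.le le_rfl (.inl rfl) ?_)]
      · simp [hck.ne]
      · intro i hi h
        have : (r + Pi.single d 1 : Fin n → ℕ) i ≠ 0 := fun h0 => h (by
          rw [Pi.sub_apply, h0, Nat.zero_sub])
        rcases add_single_ne_zero.1 this with rfl | h'
        · exact hdc
        · exact hr i hi h'
    rw [add_tsub_cancel_right] at hc
    refine ⟨hr, m, h2, hmc, h4, ?_, ?_⟩
    · simp [rowRun, hc, hm, hck.ne, hmk]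
    · simp [rowRun, hc', hm, hmk]
  · left
    push Not at hr
    obtain ⟨i, hi, hri, hci⟩ := hr
    obtain ⟨h1, h2, h3⟩ := rowTop_spec hi hri
    generalize rowTop k r = t at *
    have hct : c < t := hci.trans_le (h3 i hi hri)
    have hc := rowInsert_of_ne (r := r) hck.ne
      (rowTop_add_single_eq hck.le h1 hct.le (.inr h2) h3)
    have hd := rowInsert_of_ne (r := r) hdk.ne
      (rowTop_add_single_eq hdk.le h1 (hdc.trans hct.le) (.inr h2) h3)
    have he : r + Pi.single c 1 - Pi.single t 1 + Pi.single d 1 =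
        r + Pi.single d 1 - Pi.single t 1 + Pi.single c 1 := by
      funext i
      rcases eq_or_ne i t with rfl | hit
      · simp only [Pi.add_apply, Pi.sub_apply, Pi.single_eq_same,
          Pi.single_eq_of_ne hct.ne', Pi.single_eq_of_ne (hdc.trans_lt hct).ne']
      · simp only [Pi.add_apply, Pi.sub_apply, Pi.single_eq_of_ne hit]
        omega
    have hswap : rowInsert k (r + Pi.single c 1 - Pi.single t 1) d =
        rowInsert k (r + Pi.single d 1 - Pi.single t 1) c := by
      rw [rowInsert_of_ne hdk.ne rfl, rowInsert_of_ne hck.ne rfl, he]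
    simp [rowRun, hc, hd, hswap]

theorem rowRun_zyx_zxy {k x y z : Fin n} (r : Fin n → ℕ) (hxy : x ≤ y) (hyz : y ≤ z)
    (hzk : z ≤ k) :
    (rowRun k r [z, y, x]).1 = (rowRun k r [z, x, y]).1 ∧
      IsTriplePair (rowRun k r [z, y, x]).2 (rowRun k r [z, x, y]).2 := by
  have hcons : ∀ c w, rowRun k r (c :: w) = ((rowRun k (rowInsert k r c).1 w).1,
      (rowInsert k r c).2 ++ (rowRun k (rowInsert k r c).1 w).2) := fun _ _ => rfl
  rcases eq_or_lt_of_le hzk with rfl | hzk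
  · rcases eq_or_lt_of_le hyz with rfl | hyz
    · rcases eq_or_lt_of_le hxy with rfl | hxy
      · exact ⟨rfl, .inl rfl⟩
      -- the two copies of the largest letter, one of which `x` removes
      have h1 : ∀ s : Fin n → ℕ, rowInsert y (s + Pi.single y 1) x = (s + Pi.single x 1, []) := by
        intro s
        rw [rowInsert_of_ne hxy.ne (rowTop_add_single_eq hxy.le le_rfl hxy.le (.inr (by simp))
          fun _ h _ => h), add_right_comm, add_tsub_cancel_right]
        simp
      have : rowRun y r [y, y, x] = rowRun y r [y, x, y] := by
        simp [rowRun, rowInsert_self, h1, add_right_comm]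
      rw [this]
      exact ⟨rfl, .inl rfl⟩
    · have hxz := hxy.trans_lt hyz
      have h1 : ∀ c < z, rowInsert z (r + Pi.single z 1) c = (r + Pi.single c 1, []) := by
        intro c hc
        rw [rowInsert_of_ne hc.ne (rowTop_add_single_eq hc.le le_rfl hc.le (.inr (by simp))
          fun _ h _ => h), add_right_comm, add_tsub_cancel_right]
        simp
      have h2 : rowInsert z (r + Pi.single y 1) x = rowInsert z (r + Pi.single x 1) y := by
        rw [rowInsert_of_ne hxz.ne rfl, rowInsert_of_ne hyz.ne rfl, add_right_comm]
      have : rowRun z r [z, y, x] = rowRun z r [z, x, y] := by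
        simp [rowRun, rowInsert_self, h1 y hyz, h1 x hxz, h2]
      rw [this]
      exact ⟨rfl, .inl rfl⟩
  · obtain ⟨h1, h2, h3, h4⟩ := rowTop_add_single_spec r hzk.le
    have hz := rowInsert_of_ne (r := r) hzk.ne rfl
    generalize rowTop k (r + Pi.single z 1) = m at *
    rw [hcons, hcons, hz]
    dsimp only
    rcases rowInsert_swap (r + Pi.single z 1 - Pi.single m 1) (hyz.trans_lt hzk) hxy with
      h | ⟨ha, N, hxN, hNy, hN, hr1, hr2⟩
    · rw [h]
      exact ⟨rfl, .inl rfl⟩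
    rw [hr1, hr2]
    refine ⟨rfl, ?_⟩
    rcases eq_or_ne m k with rfl | hmk
    · -- the letter `z` stays in the row, hence `y = z = N`
      have hzr : (r + Pi.single z 1 - Pi.single m 1 : Fin n → ℕ) z ≠ 0 := by
        simp [hzk.ne]
      have hy := ha z hzk.le hzr
      have hN' := hN z hzk.le hzr
      obtain rfl := le_antisymm hNy (hyz.trans hN')
      exact .inl rfl
    · refine .inr ⟨N, y, m, hNy, hyz.trans h2, ?_, ?_⟩
      · left; simp [hmk]
      · right; left; simp [hmk]

theorem rowRun_zyx_yzx {k x y z : Fin n} (r : Fin n → ℕ) (hxy : x ≤ y) (hyz : y ≤ z)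
    (hzk : z ≤ k) :
    (rowRun k r [z, y, x]).1 = (rowRun k r [y, z, x]).1 ∧
      IsTriplePair (rowRun k r [z, y, x]).2 (rowRun k r [y, z, x]).2 := by
  rcases eq_or_lt_of_le hzk with rfl | hzk
  · rcases eq_or_lt_of_le hyz with rfl | hyz
    · exact ⟨rfl, .inl rfl⟩
    have hxz := hxy.trans_lt hyz
    have h1 : ∀ (s : Fin n → ℕ), ∀ c < z,
        rowInsert z (s + Pi.single z 1) c = (s + Pi.single c 1, []) := by
      intro s c hc
      rw [rowInsert_of_ne hc.ne (rowTop_add_single_eq hc.le le_rfl hc.le (.inr (by simp))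
        fun _ h _ => h), add_right_comm, add_tsub_cancel_right]
      simp
    obtain ⟨m1, m2, m3, m4⟩ := rowTop_add_single_spec r hyz.le
    have hy := rowInsert_of_ne (r := r) hyz.ne rfl
    generalize rowTop z (r + Pi.single y 1) = m at *
    have hm0 : (r + Pi.single y 1 : Fin n → ℕ) m ≠ 0 := add_single_ne_zero.2 m3
    have hx := rowInsert_of_ne (r := r + Pi.single y 1) hxz.ne
      (rowTop_add_single_eq hxz.le m1 (hxy.trans m2) (.inr hm0) fun i hi h => by
        rcases add_single_ne_zero.1 h with rfl | h
        · exact m2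
        · exact m4 i hi h)
    have he : r + Pi.single y 1 + Pi.single x 1 - Pi.single m 1 =
        r + Pi.single y 1 - Pi.single m 1 + Pi.single x 1 := add_sub_single hm0 _
    have : rowRun z r [z, y, x] = rowRun z r [y, z, x] := by
      simp [rowRun, rowInsert_self, hy, h1 r y hyz, h1 _ x hxz, hx, he]
    rw [this]
    exact ⟨rfl, .inl rfl⟩
  · rw [show [z, y, x] = [z, y] ++ [x] from rfl, show [y, z, x] = [y, z] ++ [x] from rfl,
      rowRun_append, rowRun_append]
    rcases rowInsert_swap r hzk hyz with h | ⟨ha, N, hyN, hNz, hN, hr1, hr2⟩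
    · rw [h]
      exact ⟨rfl, .inl rfl⟩
    rw [hr1, hr2]
    refine ⟨rfl, ?_⟩
    have hxk := (hxy.trans hyz).trans_lt hzk
    set s : Fin n → ℕ := r + Pi.single y 1 - Pi.single N 1 with hs
    obtain ⟨p1, p2, p3, p4⟩ := rowTop_add_single_spec s hxk.le
    have hx := rowInsert_of_ne (r := s) hxk.ne rfl
    generalize rowTop k (s + Pi.single x 1) = P at *
    have hPN : P ≤ N := by
      rcases p3 with rfl | hp
      · exact hxy.trans hyN
      · have : (r + Pi.single y 1 : Fin n → ℕ) P ≠ 0 := fun h0 => hp (by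
          rw [hs, Pi.sub_apply, h0, Nat.zero_sub])
        rcases add_single_ne_zero.1 this with rfl | h'
        · exact hyN
        · exact hN P p1 h'
    have hPk := ((hPN.trans hNz).trans_lt hzk).ne
    refine .inr ⟨P, N, z, hPN, hNz, ?_, ?_⟩
    · left; simp [rowRun, hx, hPk]
    · right; right; simp [rowRun, hx, hPk]

/-- Insertion is invariant under the defining relations: the rows are treated one after the other,
and what the two sides of a relation hand on to the next row is again equal or related. -/
theorem rightInsert_triple {ks : List (Fin n)} (hks : IsLowerChain ks)
    (σ : Fin n → Fin n → ℕ) {p t t' q : List (Fin n)} (ht : IsTriplePair t t')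
    (hw : ∀ c ∈ p ++ t ++ q, c ∈ ks) :
    rightInsert ks σ (p ++ t ++ q) = rightInsert ks σ (p ++ t' ++ q) := by
  induction ks generalizing p t t' q with
  | nil => rfl
  | cons k ks ih =>
    have hstep : ∀ t₁ t₂ : List (Fin n), (∀ c ∈ p ++ t₁ ++ q, c ∈ k :: ks) →
        (∀ s, (rowRun k s t₁).1 = (rowRun k s t₂).1 ∧
          IsTriplePair (rowRun k s t₁).2 (rowRun k s t₂).2) →
        rightInsert (k :: ks) σ (p ++ t₁ ++ q) = rightInsert (k :: ks) σ (p ++ t₂ ++ q) := by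
      intro t₁ t₂ hm hs
      obtain ⟨h1, h2⟩ := hs (rowRun k (σ k) p).1
      have hout := hks.rowRun_mem hm (σ k)
      simp only [rightInsert, rowRun_append] at hout ⊢
      rw [← h1, ih hks.tail h2 hout]
    rcases ht with rfl | ⟨x, y, z, hxy, hyz, h, h'⟩
    · rfl
    have hzk : z ≤ k := hks.le_of_mem_cons (hw z (by
      rcases h with rfl | rfl | rfl <;> simp))
    have hmem : ∀ t₁, IsTriple x y z t₁ → ∀ c ∈ p ++ t₁ ++ q, c ∈ k :: ks := by
      intro t₁ h₁ c hc
      refine hw c ?_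
      rcases h with rfl | rfl | rfl <;> rcases h₁ with rfl | rfl | rfl <;>
        simp only [List.mem_append, List.mem_cons, List.not_mem_nil, or_false] at hc ⊢ <;> tauto
    have key : ∀ t₁, IsTriple x y z t₁ → rightInsert (k :: ks) σ (p ++ [z, y, x] ++ q) =
        rightInsert (k :: ks) σ (p ++ t₁ ++ q) := by
      intro t₁ h₁
      rcases h₁ with rfl | rfl | rfl
      · rfl
      · exact hstep _ _ (hmem _ (.inl rfl)) fun s => rowRun_zyx_zxy s hxy hyz hzk
      · exact hstep _ _ (hmem _ (.inl rfl)) fun s => rowRun_zyx_yzx s hxy hyz hzk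
    rw [← key t h, ← key t' h']

/-- The rows of the staircase, from the lowest up. -/
def allRows (n : ℕ) : List (Fin n) := (List.finRange n).reverse

theorem mem_allRows (k : Fin n) : k ∈ allRows n := by simp [allRows]

theorem isLowerChain_allRows : IsLowerChain (allRows n) :=
  ⟨List.pairwise_reverse.2 (List.pairwise_lt_finRange n), fun _ _ j _ => mem_allRows j⟩

theorem rightInsert_eq_of_wordValue_eq (σ : Fin n → Fin n → ℕ) {u v : List (Fin n)}
    (h : wordValue (chineseGen n) u = wordValue (chineseGen n) v) :
    rightInsert (allRows n) σ u = rightInsert (allRows n) σ v := by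
  let c : Con (FreeMonoid (Fin n)) :=
    { r := fun u v => ∀ p q : List (Fin n),
        rightInsert (allRows n) σ (p ++ u.toList ++ q) =
          rightInsert (allRows n) σ (p ++ v.toList ++ q)
      iseqv := ⟨fun _ _ _ => rfl, fun h p q => (h p q).symm, fun h h' p q => (h p q).trans (h' p q)⟩
      mul' := by
        intro u u' v v' h h' p q
        have h1 := h p (v.toList ++ q)
        have h2 := h' (p ++ u'.toList) q
        simp only [FreeMonoid.toList_mul, List.append_assoc] at h1 h2 ⊢
        exact h1.trans h2 }
  have hc : conGen (ChineseRel n) ≤ c := by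
    refine Con.conGen_le.2 fun a b hab p q => ?_
    cases hab with
    | zyx_zxy x y z hxy hyz =>
      exact rightInsert_triple isLowerChain_allRows σ
        (.inr ⟨x, y, z, hxy, hyz, .inl rfl, .inr (.inl rfl)⟩) fun c _ => mem_allRows c
    | zxy_yzx x y z hxy hyz =>
      exact rightInsert_triple isLowerChain_allRows σ
        (.inr ⟨x, y, z, hxy, hyz, .inr (.inl rfl), .inr (.inr rfl)⟩) fun c _ => mem_allRows c
  have hmk : ∀ u : List (Fin n), wordValue (chineseGen n) u =
      PresentedMonoid.mk (ChineseRel n) (FreeMonoid.ofList u) := by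
    intro u
    induction u with
    | nil => rfl
    | cons a u ih =>
      rw [FreeMonoid.ofList_cons, map_mul, ← ih]
      simp [wordValue, chineseGen, PresentedMonoid.of]
  rw [hmk, hmk, PresentedMonoid.mk_eq_mk_iff] at h
  simpa using hc h [] []

theorem rowRun_zero {k : Fin n} {w : List (Fin n)} (hw : ∀ c ∈ w, c < k) :
    rowRun k 0 w = (0, w) := by
  induction w with
  | nil => rfl
  | cons c w ih =>
    have hc := hw c (by simp)
    have h : rowInsert k 0 c = (0, [c]) := by
      rw [rowInsert_of_ne hc.ne (rowTop_add_single_eq hc.le hc.le le_rfl (.inl rfl) (by simp)),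
        add_tsub_cancel_right, if_neg hc.ne]
    simp [rowRun, h, ih fun c hc => hw c (by simp [hc])]

theorem rowRun_unitWord {k j : Fin n} (r : Fin n → ℕ) (hj : j ≤ k) :
    rowRun k r (unitWord k j) = (r + Pi.single j 1, []) := by
  rcases eq_or_ne j k with rfl | h
  · simp [unitWord, rowRun, rowInsert_self]
  · have : rowInsert k (r + Pi.single k 1) j = (r + Pi.single j 1, []) := by
      rw [rowInsert_of_ne h (rowTop_add_single_eq hj le_rfl hj (.inr (by simp))
        fun _ h _ => h), add_right_comm, add_tsub_cancel_right]
      simp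
    simp [unitWord, h, rowRun, rowInsert_self, this]

theorem rowRun_flatten_replicate {k j : Fin n} (a : ℕ) (r : Fin n → ℕ) (hj : j ≤ k) :
    rowRun k r (List.replicate a (unitWord k j)).flatten = (r + Pi.single j a, []) := by
  induction a generalizing r with
  | zero => simp [rowRun]
  | succ a ih =>
    rw [List.replicate_succ, List.flatten_cons, rowRun_append, rowRun_unitWord r hj, ih,
      add_assoc, ← Pi.single_add, add_comm 1 a]
    rfl

theorem rowRun_flatMap {k : Fin n} (s : Fin n → ℕ) {l : List (Fin n)} (hl : l.Nodup)
    (hlk : ∀ j ∈ l, j ≤ k) (r : Fin n → ℕ) :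
    rowRun k r (l.flatMap fun j => (List.replicate (s j) (unitWord k j)).flatten) =
      (fun j => r j + if j ∈ l then s j else 0, []) := by
  induction l generalizing r with
  | nil => simp [rowRun]
  | cons i l ih =>
    obtain ⟨hi, hl⟩ := List.nodup_cons.1 hl
    rw [List.flatMap_cons, rowRun_append, rowRun_flatten_replicate _ r (hlk i (by simp)),
      ih hl fun j hj => hlk j (by simp [hj])]
    refine Prod.ext (funext fun j => ?_) rfl
    rcases eq_or_ne j i with rfl | h
    · simp [hi]
    · simp [h]

theorem rowRun_chineseRow (σ : Fin n → Fin n → ℕ) (k : Fin n) :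
    rowRun k 0 (chineseRow σ k) = (fun j => if j ≤ k then σ k j else 0, []) := by
  rw [chineseRow_eq, rowRun_flatMap _ (nodup_rowIndices k) fun _ => mem_rowIndices.1]
  simp [mem_rowIndices]

theorem le_of_mem_chineseRow {σ : Fin n → Fin n → ℕ} {k c : Fin n} (hc : c ∈ chineseRow σ k) :
    c ≤ k := by
  rw [chineseRow_eq] at hc
  obtain ⟨j, hj, hc⟩ := List.mem_flatMap.1 hc
  have hjk := mem_rowIndices.1 hj
  obtain ⟨l, hl, hc⟩ := List.mem_flatten.1 hc
  obtain rfl := List.eq_of_mem_replicate hl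
  unfold unitWord at hc
  split_ifs at hc
  · simp at hc; exact hc.le
  · simp at hc; rcases hc with rfl | rfl
    · exact le_rfl
    · exact hjk

/-- Insertion of a staircase word into the empty staircase recovers its exponents. -/
theorem rightInsert_zero_flatMap {ks : List (Fin n)} (hks : IsLowerChain ks)
    (σ : Fin n → Fin n → ℕ) {k j : Fin n} (hk : k ∈ ks) (hj : j ≤ k) :
    rightInsert ks 0 (ks.reverse.flatMap (chineseRow σ)) k j = σ k j := by
  induction ks with
  | nil => simp at hk
  | cons l ks ih =>
    have hlt : ∀ c ∈ ks.reverse.flatMap (chineseRow σ), c < l := by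
      intro c hc
      obtain ⟨i, hi, hc⟩ := List.mem_flatMap.1 hc
      exact (le_of_mem_chineseRow hc).trans_lt (hks.lt_of_mem (by simpa using hi))
    have hrun : rowRun l 0 ((l :: ks).reverse.flatMap (chineseRow σ)) =
        (fun j => if j ≤ l then σ l j else 0, ks.reverse.flatMap (chineseRow σ)) := by
      simp only [List.reverse_cons, List.flatMap_append, rowRun_append, rowRun_zero hlt]
      simp [rowRun_chineseRow]
    rw [rightInsert, Pi.zero_apply, hrun]
    rcases eq_or_ne k l with rfl | h
    · simp [hj]
    · rw [Function.update_of_ne h]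
      exact ih hks.tail (by simpa [h] using hk)

/-- Staircase words are normal forms. -/
theorem chineseStaircaseWord_eq_of_wordValue_eq {σ τ : Fin n → Fin n → ℕ}
    (h : wordValue (chineseGen n) (chineseStaircaseWord σ) =
      wordValue (chineseGen n) (chineseStaircaseWord τ)) :
    chineseStaircaseWord σ = chineseStaircaseWord τ := by
  have key : ∀ k, ∀ j ≤ k, σ k j = τ k j := by
    intro k j hj
    have h1 := rightInsert_zero_flatMap isLowerChain_allRows σ (mem_allRows k) hj
    have h2 := rightInsert_zero_flatMap isLowerChain_allRows τ (mem_allRows k) hj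
    simp only [allRows, List.reverse_reverse] at h1 h2
    rw [← h1, ← h2]
    exact congrFun (congrFun (rightInsert_eq_of_wordValue_eq 0 h) k) j
  refine List.flatMap_congr fun k _ => ?_
  rw [chineseRow_eq, chineseRow_eq]
  exact List.flatMap_congr fun j hj => by rw [key k j (mem_rowIndices.1 hj)]

theorem wordValue_staircase_append (σ : Fin n → Fin n → ℕ) (w : List (Fin n)) :
    wordValue (chineseGen n) (chineseStaircaseWord σ ++ w) =
      wordValue (chineseGen n) (chineseStaircaseWord (rightInsert (allRows n) σ w)) := by
  have h := rowsVal_mul_wordValue isLowerChain_allRows σ fun c (_ : c ∈ w) => mem_allRows c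
  rw [wordValue_append, chineseStaircaseWord, chineseStaircaseWord, wordValue_flatMap_chineseRow,
    wordValue_flatMap_chineseRow]
  simpa [allRows] using h

theorem rowInsert_add {k c : Fin n} {r s : Fin n → ℕ} (hc : c ≤ k)
    (hs : ∀ j, r j = 0 → s j = 0) :
    rowInsert k (r + s) c = ((rowInsert k r c).1 + s, (rowInsert k r c).2) := by
  rcases eq_or_ne c k with rfl | hck
  · simp [rowInsert_self, add_right_comm]
  obtain ⟨h1, h2, h3, h4⟩ := rowTop_add_single_spec r hc
  have hr := rowInsert_of_ne (r := r) hck rfl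
  generalize rowTop k (r + Pi.single c 1) = m at *
  have hm0 : (r + Pi.single c 1 : Fin n → ℕ) m ≠ 0 := add_single_ne_zero.2 h3
  rw [hr, rowInsert_of_ne hck (rowTop_add_single_eq hc h1 h2 ?_ ?_)]
  · rw [add_right_comm, add_sub_single hm0]
  · exact h3.imp_right fun h => by simp [h]
  · intro i hi h
    refine h4 i hi fun h0 => h ?_
    simp [h0, hs i h0]

theorem length_rowInsert_le (k : Fin n) (r : Fin n → ℕ) (c : Fin n) :
    (rowInsert k r c).2.length ≤ 1 := by
  unfold rowInsert
  split_ifs <;> simp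

/-- A single letter is inserted by changing exponents by amounts that depend only on the set of
nonzero exponents. -/
theorem rightInsert_add {ks : List (Fin n)} (hks : IsLowerChain ks) {σ τ : Fin n → Fin n → ℕ}
    (h : ∀ k j, σ k j = 0 → τ k j = 0) {w : List (Fin n)} (hw : ∀ c ∈ w, c ∈ ks)
    (hl : w.length ≤ 1) : rightInsert ks (σ + τ) w = rightInsert ks σ w + τ := by
  induction ks generalizing w with
  | nil => rfl
  | cons k ks ih =>
    have hrow : rowRun k ((σ + τ) k) w = ((rowRun k (σ k) w).1 + τ k, (rowRun k (σ k) w).2) := by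
      rcases w with _ | ⟨c, _ | ⟨d, w⟩⟩
      · rfl
      · simp [rowRun, rowInsert_add (hks.le_of_mem_cons (hw c (by simp))) (h k)]
      · simp at hl
    have hlen : (rowRun k (σ k) w).2.length ≤ 1 := by
      rcases w with _ | ⟨c, _ | ⟨d, w⟩⟩
      · simp [rowRun]
      · simpa [rowRun] using length_rowInsert_le k (σ k) c
      · simp at hl
    rw [rightInsert, hrow, rightInsert]
    dsimp only
    rw [ih hks.tail (hks.rowRun_mem hw _) hlen]
    funext i
    rcases eq_or_ne i k with rfl | hi
    · simp
    · simp [hi]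

end RightInsertion

/-! ### Insertion from the left -/

section LeftInsertion

variable {n : ℕ}

/-- The second letter of the unit that leaves the `k`-th row when the unit word of a letter `l > k`
with second letter `j` enters it from the left: the smallest index of the row if that is less than
`j`, and `j` itself otherwise. The letter `l` alone counts as the unit with `j = l`. -/
def rowCarry (k : Fin n) (r : Fin n → ℕ) (j : Fin n) : Fin n :=
  if h : (Finset.univ.filter fun i => i ≤ k ∧ r i ≠ 0 ∧ i < j).Nonempty then Finset.min' _ h
  else j

/-- The `k`-th row after the unit word of a letter `l > k` with second letter `j` has passed through
it. If it leaves with another second letter `i`, then a unit with index `i` of the row has become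
one with index `j`; for `j = l` this is the single letter `k`, or nothing if also `i = k`. -/
def rowPass (k : Fin n) (r : Fin n → ℕ) (j : Fin n) : Fin n → ℕ :=
  if rowCarry k r j < j then
    r - Pi.single (rowCarry k r j) 1 + if rowCarry k r j = k then 0 else Pi.single (min j k) 1
  else r

theorem rowCarry_spec (k : Fin n) (r : Fin n → ℕ) (j : Fin n) :
    (rowCarry k r j < j ∧ rowCarry k r j ≤ k ∧ r (rowCarry k r j) ≠ 0 ∧
      ∀ i ≤ k, r i ≠ 0 → rowCarry k r j ≤ i) ∨
    (rowCarry k r j = j ∧ ∀ i ≤ k, r i ≠ 0 → j ≤ i) := by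
  unfold rowCarry
  split_ifs with h
  · left
    obtain ⟨-, h1, h2, h3⟩ := Finset.mem_filter.1 (Finset.min'_mem _ h)
    refine ⟨h3, h1, h2, fun i hi hri => ?_⟩
    by_cases hij : i < j
    · exact Finset.min'_le _ _ (by simp [hi, hri, hij])
    · exact h3.le.trans (not_lt.1 hij)
  · right
    refine ⟨rfl, fun i hi hri => not_lt.1 fun hij => h ⟨i, by simp [hi, hri, hij]⟩⟩

theorem rowCarry_add (k : Fin n) {r s : Fin n → ℕ} (h : ∀ j, r j = 0 → s j = 0) (j : Fin n) :
    rowCarry k (r + s) j = rowCarry k r j := by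
  have : ∀ i, (r + s) i ≠ 0 ↔ r i ≠ 0 := fun i => by
    have := h i
    simp only [Pi.add_apply]
    omega
  simp only [rowCarry, this]

theorem rowPass_add (k : Fin n) {r s : Fin n → ℕ} (h : ∀ j, r j = 0 → s j = 0) (j : Fin n) :
    rowPass k (r + s) j = rowPass k r j + s := by
  rw [rowPass, rowPass, rowCarry_add k h]
  rcases rowCarry_spec k r j with ⟨h1, -, h2, -⟩ | ⟨h1, -⟩
  · rw [if_pos h1, if_pos h1, add_right_comm _ _ s, add_sub_single h2]
  · simp [h1]

/-- A unit of a letter `l` exchanges its second letter with a unit of a letter `k < l`. -/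
theorem unitVal_mul_unitVal {i j k l : Fin n} (hik : i ≤ k) (hij : i < j) (hkl : k < l)
    (hj : j = l ∨ j < k) :
    unitVal l j * unitVal k i =
      unitVal l i * if i = k then 1 else unitVal k (min j k) := by
  have hil : i ≠ l := (hik.trans_lt hkl).ne
  rcases hj with rfl | hjk
  · rw [unitVal_self, unitVal_of_ne hil, min_eq_right hkl.le]
    split_ifs with h
    · rw [h, unitVal_self, mul_one]
    · rw [unitVal_of_ne h, unitVal_self, ← mul_assoc, chineseGen_zyx hik hkl.le]
  · have hik' := hij.trans hjk
    rw [if_neg hik'.ne, min_eq_left hjk.le, unitVal_of_ne (hjk.trans hkl).ne,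
      unitVal_of_ne hik'.ne, unitVal_of_ne hil, unitVal_of_ne hjk.ne, mul_assoc,
      ← mul_assoc (chineseGen n j), ← chineseGen_zxy hij.le hjk.le, ← mul_assoc, ← mul_assoc,
      chineseGen_zyx hik hkl.le, ← mul_assoc]

theorem unitVal_mul_rowVal {j k l : Fin n} (r : Fin n → ℕ) (hkl : k < l) (hj : j = l ∨ j < k) :
    unitVal l j * rowVal k r = rowVal k (rowPass k r j) * unitVal l (rowCarry k r j) := by
  rw [rowPass]
  rcases rowCarry_spec k r j with ⟨h1, h2, h3, h4⟩ | ⟨h1, h2⟩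
  · rw [if_pos h1]
    generalize rowCarry k r j = i at *
    have hrow : Commute (unitVal l i) (rowVal k (r - Pi.single i 1)) :=
      commute_rowVal fun m hm hrm =>
        commute_unitVal (h4 m hm fun h0 => hrm (by simp [h0])) hm hkl.le
    have hself : Commute (unitVal k i) (rowVal k (r - Pi.single i 1)) :=
      commute_rowVal fun m hm _ => commute_unitVal_row h2 hm
    rw [← rowVal_sub_single_mul h2 h3, ← hself.eq, ← mul_assoc,
      unitVal_mul_unitVal h2 h1 hkl hj]
    split_ifs with h
    · rw [mul_one, add_zero, hrow.eq]
    · have hmin : Commute (unitVal l i) (unitVal k (min j k)) :=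
        commute_unitVal (le_min h1.le h2) (min_le_right _ _) hkl.le
      have hminrow : Commute (unitVal k (min j k)) (rowVal k (r - Pi.single i 1)) :=
        commute_rowVal fun m hm _ => commute_unitVal_row (min_le_right _ _) hm
      rw [rowVal_add_single _ (min_le_right _ _), mul_assoc, hminrow.eq,
        (hrow.mul_right hmin).eq]
  · rw [h1, if_neg (lt_irrefl j)]
    exact commute_rowVal fun i hi hri => commute_unitVal (h2 i hi hri) hi hkl.le

/-- Insertion from the left of the unit word of the letter `l` with second letter `j` into the rows
listed in `ks`, the first of which is the highest row: the unit passes through the rows above the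
`l`-th, where it stays. -/
def leftInsert (l : Fin n) : List (Fin n) → (Fin n → Fin n → ℕ) → Fin n → Fin n → Fin n → ℕ
  | [], σ, _ => σ
  | k :: ks, σ, j =>
    if k = l then Function.update σ k (σ k + Pi.single j 1)
    else Function.update (leftInsert l ks σ (rowCarry k (σ k) j)) k (rowPass k (σ k) j)

theorem rowsVal_cons (k : Fin n) (ks : List (Fin n)) (σ : Fin n → Fin n → ℕ) :
    rowsVal (k :: ks) σ = rowVal k (σ k) * rowsVal ks σ := by
  simp [rowsVal]

theorem unitVal_mul_rowsVal {l : Fin n} {ks : List (Fin n)} (hks : ks.Pairwise (· < ·))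
    (hl : l ∈ ks) (σ : Fin n → Fin n → ℕ) {j : Fin n} (hj : j = l ∨ ∀ k ∈ ks, j < k) :
    unitVal l j * rowsVal ks σ = rowsVal ks (leftInsert l ks σ j) := by
  induction ks generalizing j with
  | nil => simp at hl
  | cons k ks ih =>
    obtain ⟨hk, hks⟩ := List.pairwise_cons.1 hks
    have hkn : k ∉ ks := fun h => (hk k h).false
    rw [rowsVal_cons, rowsVal_cons, leftInsert, ← mul_assoc]
    split_ifs with hkl
    · subst hkl
      have hjk : j ≤ k := hj.elim le_of_eq fun h => (h k (by simp)).le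
      have : Commute (unitVal k j) (rowVal k (σ k)) :=
        commute_rowVal fun m hm _ => commute_unitVal_row hjk hm
      rw [rowsVal_update hkn, Function.update_self, rowVal_add_single _ hjk, this.eq]
    · have hl' : l ∈ ks := by simpa [Ne.symm hkl] using hl
      rw [rowsVal_update hkn, Function.update_self,
        unitVal_mul_rowVal _ (hk l hl') (hj.imp_right fun h => h k (by simp)), mul_assoc,
        ih hks hl']
      rcases rowCarry_spec k (σ k) j with ⟨-, h, -⟩ | ⟨h, -⟩
      · exact .inr fun m hm => h.trans_lt (hk m hm)
      · rw [h]
        exact hj.imp_right fun h m hm => h m (by simp [hm])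

theorem wordValue_cons_staircase (σ : Fin n → Fin n → ℕ) (l : Fin n) :
    wordValue (chineseGen n) (l :: chineseStaircaseWord σ) =
      wordValue (chineseGen n) (chineseStaircaseWord (leftInsert l (List.finRange n) σ l)) := by
  have h := unitVal_mul_rowsVal (List.pairwise_lt_finRange n) (List.mem_finRange l) σ (.inl rfl)
  rw [chineseStaircaseWord, chineseStaircaseWord, wordValue_flatMap_chineseRow, ← h,
    ← wordValue_flatMap_chineseRow, unitVal_self]
  simp [wordValue]

theorem leftInsert_add (l : Fin n) (ks : List (Fin n)) {σ τ : Fin n → Fin n → ℕ}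
    (h : ∀ k j, σ k j = 0 → τ k j = 0) (j : Fin n) :
    leftInsert l ks (σ + τ) j = leftInsert l ks σ j + τ := by
  induction ks generalizing j with
  | nil => rfl
  | cons k ks ih =>
    rw [leftInsert, leftInsert, Pi.add_apply, rowCarry_add k (h k), rowPass_add k (h k), ih]
    split_ifs <;> funext i <;> rcases eq_or_ne i k with rfl | hi
    · simp [add_right_comm]
    · simp [hi]
    · simp
    · simp [hi]

end LeftInsertion

/-! ### The biautomatic structure -/

section Biautomatic

variable {n : ℕ}

/-- The positions of the staircase, row by row. -/
def staircaseIndices (n : ℕ) : List (Fin n × Fin n) :=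
  (List.finRange n).flatMap fun k => (rowIndices k).map fun j => (k, j)

theorem nodup_staircaseIndices (n : ℕ) : (staircaseIndices n).Nodup := by
  refine List.nodup_flatMap.2 ⟨fun k _ => (nodup_rowIndices k).map (Prod.mk_right_injective k),
    (List.nodup_finRange n).imp fun {a b} hab => ?_⟩
  simp only [Function.onFun, List.disjoint_left, List.mem_map]
  rintro _ ⟨j, -, rfl⟩ ⟨j', -, h⟩
  exact hab (Prod.mk.inj h).1.symm

/-- The word `unitWord` at a position of the staircase. -/
def positionWord (p : Fin n × Fin n) : List (Fin n) := unitWord p.1 p.2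

theorem chineseStaircaseWord_eq (σ : Fin n → Fin n → ℕ) :
    chineseStaircaseWord σ = powerWord positionWord (staircaseIndices n) (Function.uncurry σ) := by
  rw [chineseStaircaseWord, powerWord, staircaseIndices, List.flatMap_assoc]
  refine List.flatMap_congr fun k _ => ?_
  rw [chineseRow_eq, List.flatMap_map]
  rfl

/-- A relation on staircase words of the form `f(u) = v` in the Chinese monoid is the graph of the
transformation of exponents that describes `f`, because staircase words are normal forms. -/
theorem staircaseRel_eq (f : List (Fin n) → List (Fin n))
    (F : (Fin n → Fin n → ℕ) → Fin n → Fin n → ℕ)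
    (hF : ∀ σ, wordValue (chineseGen n) (f (chineseStaircaseWord σ)) =
      wordValue (chineseGen n) (chineseStaircaseWord (F σ))) :
    {p | p.1 ∈ chineseStaircaseLanguage n ∧ p.2 ∈ chineseStaircaseLanguage n ∧
      wordValue (chineseGen n) (f p.1) = wordValue (chineseGen n) p.2} =
    powerWordRel positionWord (staircaseIndices n)
      fun σ => Function.uncurry (F (Function.curry σ)) := by
  ext ⟨u, v⟩
  constructor
  · rintro ⟨⟨σ, hu⟩, ⟨τ, hv⟩, h⟩
    dsimp only at hu hv h
    subst hu hv
    rw [hF] at h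
    refine ⟨Function.uncurry σ, ?_⟩
    dsimp only
    rw [← chineseStaircaseWord_eq σ, Function.curry_uncurry, ← chineseStaircaseWord_eq,
      chineseStaircaseWord_eq_of_wordValue_eq h]
  · rintro ⟨σ, h⟩
    have hσ := chineseStaircaseWord_eq (Function.curry σ)
    rw [Function.uncurry_curry] at hσ
    rw [← hσ, ← chineseStaircaseWord_eq] at h
    obtain ⟨rfl, rfl⟩ := Prod.mk.inj h
    exact ⟨⟨_, rfl⟩, ⟨_, rfl⟩, hF _⟩

theorem isSupportLocal_uncurry {F : (Fin n → Fin n → ℕ) → Fin n → Fin n → ℕ}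
    (hF : ∀ σ τ : Fin n → Fin n → ℕ, (∀ k j, σ k j = 0 → τ k j = 0) → F (σ + τ) = F σ + τ) :
    IsSupportLocal fun σ : Fin n × Fin n → ℕ => Function.uncurry (F (Function.curry σ)) := by
  intro σ τ h
  have := hF (Function.curry σ) (Function.curry τ) fun k j => h (k, j)
  funext p
  exact congrFun (congrFun this p.1) p.2

theorem exists_rightMulRel_eq (a : Option (Fin n)) :
    ∃ F : (Fin n × Fin n → ℕ) → Fin n × Fin n → ℕ, IsSupportLocal F ∧
      rightMulRel (chineseGen n) (chineseStaircaseLanguage n) a =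
        powerWordRel positionWord (staircaseIndices n) F :=
  ⟨_, isSupportLocal_uncurry fun _ _ h => rightInsert_add isLowerChain_allRows h
      (fun c (_ : c ∈ a.toList) => mem_allRows c) (by cases a <;> simp),
    staircaseRel_eq (fun u => u ++ a.toList) _ fun σ => wordValue_staircase_append σ _⟩

theorem exists_leftMulRel_eq (a : Option (Fin n)) :
    ∃ F : (Fin n × Fin n → ℕ) → Fin n × Fin n → ℕ, IsSupportLocal F ∧
      leftMulRel (chineseGen n) (chineseStaircaseLanguage n) a =
        powerWordRel positionWord (staircaseIndices n) F := by
  cases a with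
  | none =>
    exact ⟨_, isSupportLocal_uncurry (F := id) fun _ _ _ => rfl,
      staircaseRel_eq (fun u => [] ++ u) _ fun _ => rfl⟩
  | some l =>
    exact ⟨_, isSupportLocal_uncurry fun _ _ h => leftInsert_add l (List.finRange n) h l,
      staircaseRel_eq (fun u => [l] ++ u) _ fun σ => wordValue_cons_staircase σ l⟩

theorem isRegular_chineseStaircaseLanguage (n : ℕ) :
    (chineseStaircaseLanguage n).IsRegular := by
  refine (isSupportLocal_id.hasFiniteQuotients (positionWord (n := n))
    (nodup_staircaseIndices n)).isRegular_of_diagonal fun u => ⟨?_, ?_⟩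
  · rintro ⟨σ, rfl⟩
    exact ⟨Function.uncurry σ, by rw [id, ← chineseStaircaseWord_eq]⟩
  · rintro ⟨σ, h⟩
    refine ⟨Function.curry σ, ?_⟩
    rw [chineseStaircaseWord_eq, Function.uncurry_curry]
    exact (Prod.mk.inj h).1

theorem exists_staircase_wordValue_eq (m : ChineseMonoid n) :
    ∃ u ∈ chineseStaircaseLanguage n, wordValue (chineseGen n) u = m := by
  have hm : m ∈ Submonoid.closure (Set.range (chineseGen n)) := by
    rw [show Set.range (chineseGen n) = Set.range (PresentedMonoid.of (ChineseRel n)) from rfl,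
      PresentedMonoid.closure_range_of]
    trivial
  induction hm using Submonoid.closure_induction_right with
  | one =>
    refine ⟨_, ⟨0, rfl⟩, ?_⟩
    simp [chineseStaircaseWord, wordValue_flatMap_chineseRow, rowsVal, rowVal_zero]
  | mul_right x _ y hy ih =>
    obtain ⟨_, ⟨σ, rfl⟩, rfl⟩ := ih
    obtain ⟨a, rfl⟩ := hy
    refine ⟨_, ⟨_, rfl⟩, (wordValue_staircase_append σ [a]).symm.trans ?_⟩
    rw [wordValue_append]
    simp [wordValue]

end Biautomatic

/-- For every `n`, the standard generators together with the Chinese staircase words form a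
biautomatic structure for the Chinese monoid of rank `n`; moreover the relations of right and left
multiplication by a generator on this language are rational. -/
theorem mainTheorem2 (n : ℕ) :
    IsBiautomaticStructure (chineseGen n) (chineseStaircaseLanguage n) ∧
      ∀ γ : Fin n,
        IsRationalRelation (rightMulRel (chineseGen n) (chineseStaircaseLanguage n) (some γ)) ∧
          IsRationalRelation (leftMulRel (chineseGen n) (chineseStaircaseLanguage n) (some γ)) := by
  have hI := nodup_staircaseIndices n
  refine ⟨⟨PresentedMonoid.closure_range_of _, isRegular_chineseStaircaseLanguage n,
    exists_staircase_wordValue_eq, fun a => ?_, fun a => ?_, fun a => ?_, fun a => ?_⟩,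
    fun γ => ⟨?_, ?_⟩⟩
  · obtain ⟨F, hF, he⟩ := exists_rightMulRel_eq a
    exact he ▸ hF.isRegular_rightPadded _ hI
  · obtain ⟨F, hF, he⟩ := exists_leftMulRel_eq a
    exact he ▸ hF.isRegular_rightPadded _ hI
  · obtain ⟨F, hF, he⟩ := exists_rightMulRel_eq a
    exact he ▸ hF.isRegular_leftPadded _ hI
  · obtain ⟨F, hF, he⟩ := exists_leftMulRel_eq a
    exact he ▸ hF.isRegular_leftPadded _ hI
  · obtain ⟨F, hF, he⟩ := exists_rightMulRel_eq (some γ)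
    exact he ▸ hF.isRationalRelation _ hI
  · obtain ⟨F, hF, he⟩ := exists_leftMulRel_eq (some γ)
    exact he ▸ hF.isRationalRelation _ hI
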